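/- Let $k\ge 1$. A \emph{one-way deterministic depth-$k$ storage automaton} over a finite alphabet $\Sigma$ consists of a finite set $Q$ of states with an initial state $q_0$, disjoint sets $Q_{acc},Q_{rej}\subseteq Q$, finite pairwise disjoint storage alphabets $\Gamma^{(0)}=\{\Box\},\Gamma^{(1)},\dots,\Gamma^{(k)}=\{\triangleright,B\}$ with union $\Gamma$ (where $\triangleright\neq B$), and a transition function $\delta:Q\times(\Sigma\cup\{\triangleright,\triangleleft\})\times\Gamma\to Q\times\Gamma\times\{0,+1\}\times\{-1,0,+1\}$. The read-only input tape holds $\triangleright x\triangleleft$; the semi-infinite storage tape initially holds $\triangleright$ in its leftmost cell and $\Box$ in all other cells; the machine starts in state $q_0$ with both heads on the leftmost cells. A transition $\delta(q,\sigma,\gamma)=(p,\xi,d_1,d_2)$ changes the state from $q$ to $p$, writes $\xi$ over the scanned storage symbol $\gamma$, and moves the input head by $d_1$ and the storage head by $d_2$. It must satisfy the following: the heads do not leave their tapes ($\sigma=\triangleleft$ implies $d_1=0$, and $\gamma=\triangleright$ implies $d_2\ne-1$); $\xi=\gamma$ if $\gamma\in\Gamma^{(k)}$ or $d_2=0$;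 $\xi\neq\triangleright$ if $\gamma\ne\triangleright$; and, if $\gamma\in\Gamma^{(e)}$ with $e<k$, then $\xi\in\Gamma^{(\min\{e+1,k\})}$ when $d_2=(-1)^e$, and $\xi\in\Gamma^{(\min\{e+2,k\})}$ when $d_2=(-1)^{e+1}$. The automaton halts and accepts (respectively, rejects) when it is in a state of $Q_{acc}$ (respectively, $Q_{rej}$), and it recognizes $L\subseteq\Sigma^*$ if it accepts every $x\in L$ and rejects every $x\in\Sigma^*\setminus L$. It is \emph{depth-susceptible} if, for every transition as above, $\gamma\in\Gamma^{(k-1)}\cup\Gamma^{(k)}$ implies $d_1=0$, and $\gamma=B$ implies $p=q$. Let $k\mathrm{SDA}$ be the family of languages recognized by depth-susceptible one-way deterministic depth-$k$ storage automata, let $\omega\mathrm{SDA}=\bigcup_{k\ge1}k\mathrm{SDA}$, and let $\mathrm{DCFL}$ be the family of deterministic context-free languages, i.e., those accepted by one-way deterministic pushdown automata (by final state, after the whole input has been read). \textbf{Lemma.} $2\mathrm{SDA}=\mathrm{DCFL}$. Consequently, $\mathrm{DCFL}\subseteq k\mathrm{SDA}\subseteq(k+1)\mathrm{SDA}\subseteq\omega\mathrm{SDA}$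 for every $k\ge2$. -/

import Mathlib

/-! ## Deterministic context-free languages -/

/-- A one-way deterministic pushdown automaton over the input alphabet `α`:
finitely many inner states and stack symbols, and a partial transition function, where
`δ q (some a) X` is the move that consumes the input symbol `a` and `δ q none X` is the
`ε`-move, in state `q` with `X` on top of the stack; a move `(p, w)` replaces `X` by the word `w`
(whose first letter is the new top). Determinism: if an `ε`-move is available then no input symbol
can be consumed. -/
structure DPDA (α : Type) where
  Q : Type
  Γ : Type
  finite_Q : Finite Q
  finite_Γ : Finite Γ
  δ : Q → Option α → Γ → Option (Q × List Γ)
  start : Q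
  bottom : Γ
  final : Set Q
  deterministic : ∀ (q : Q) (X : Γ), δ q none X ≠ none → ∀ a : α, δ q (some a) X = none

namespace DPDA

variable {α : Type}

/-- An instantaneous description: inner state, unread input, stack (top first). -/
structure Cfg (M : DPDA α) where
  state : M.Q
  input : List α
  stack : List M.Γ

inductive Step (M : DPDA α) : M.Cfg → M.Cfg → Prop
  | epsilon {q p : M.Q} {X : M.Γ} {w s : List M.Γ} {x : List α} :
      M.δ q none X = some (p, w) → Step M ⟨q, x, X :: s⟩ ⟨p, x, w ++ s⟩
  | read {q p : M.Q} {X : M.Γ} {w s : List M.Γ} {a : α} {x : List α} :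
      M.δ q (some a) X = some (p, w) → Step M ⟨q, a :: x, X :: s⟩ ⟨p, x, w ++ s⟩

/-- Acceptance by final state, after the whole input has been consumed. -/
def Accepts (M : DPDA α) (x : List α) : Prop :=
  ∃ p ∈ M.final, ∃ s : List M.Γ,
    Relation.ReflTransGen M.Step ⟨M.start, x, [M.bottom]⟩ ⟨p, [], s⟩

end DPDA

/-- The deterministic context-free languages over `α`. -/
def DCFL (α : Type) : Set (Language α) :=
  {L | ∃ M : DPDA α, ∀ x : List α, x ∈ L ↔ M.Accepts x}

/-! ## Storage automata -/

/-- Symbols on the input tape: the two endmarkers and the input letters. -/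
inductive InputSymbol (α : Type) where
  | leftEnd : InputSymbol α
  | letter : α → InputSymbol α
  | rightEnd : InputSymbol α

/-- The symbol in cell `i` of the input tape holding `x` between the two endmarkers, the left
endmarker being in cell `0` and the right endmarker in cell `x.length + 1`. -/
def inputCell {α : Type} (x : List α) : ℕ → InputSymbol α
  | 0 => .leftEnd
  | i + 1 => match x[i]? with
    | some a => .letter a
    | none => .rightEnd

/-- The value of a transition: next state, symbol written on the storage tape, direction `0` or
`+1` of the input head, direction `-1`, `0` or `+1` of the storage head. -/
structure StorageMove (Q Γ : Type) where
  state : Q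
  write : Γ
  inputDir : Fin 2
  storageDir : SignType

/-- A one-way deterministic depth-`k` storage automaton over the input alphabet `α`.
The disjoint storage alphabets of levels `0, …, k` are the fibres of the depth value `dv`. -/
structure StorageAutomaton (k : ℕ) (α : Type) where
  Q : Type
  Γ : Type
  finite_Q : Finite Q
  finite_Γ : Finite Γ
  dv : Γ → ℕ
  /-- the initial blank symbol -/
  blank : Γ
  /-- the left endmarker of the storage tape -/
  leftEnd : Γ
  /-- the frozen blank symbol -/
  frozen : Γ
  dv_le : ∀ γ, dv γ ≤ k
  dv_eq_zero : ∀ γ, dv γ = 0 ↔ γ = blank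
  dv_eq_top : ∀ γ, dv γ = k ↔ γ = leftEnd ∨ γ = frozen
  leftEnd_ne_frozen : leftEnd ≠ frozen
  δ : Q → InputSymbol α → Γ → StorageMove Q Γ
  start : Q
  acc : Set Q
  rej : Set Q
  acc_rej_disjoint : Disjoint acc rej
  /-- the input head does not leave the input tape -/
  input_bounded : ∀ q γ, (δ q .rightEnd γ).inputDir = 0
  /-- the storage head does not leave the storage tape -/
  storage_bounded : ∀ q σ, (δ q σ leftEnd).storageDir ≠ -1
  /-- symbols of level `k` are never modified -/
  top_unmodified : ∀ q σ γ, dv γ = k → (δ q σ γ).write = γ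
  /-- the left endmarker is never written over another symbol -/
  leftEnd_not_written : ∀ q σ γ, γ ≠ leftEnd → (δ q σ γ).write ≠ leftEnd
  /-- a storage-stationary move leaves the scanned symbol unaltered -/
  stationary : ∀ q σ γ, (δ q σ γ).storageDir = 0 → (δ q σ γ).write = γ
  /-- depth requirement for a move that is not a turn -/
  depth_pass : ∀ q σ γ, dv γ < k → ((δ q σ γ).storageDir : ℤ) = (-1) ^ dv γ →
    dv (δ q σ γ).write = min (dv γ + 1) k
  /-- depth requirement for a turn -/
  depth_turn : ∀ q σ γ, dv γ < k → ((δ q σ γ).storageDir : ℤ) = (-1) ^ (dv γ + 1) →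
    dv (δ q σ γ).write = min (dv γ + 2) k

namespace StorageAutomaton

variable {k : ℕ} {α : Type}

/-- Depth-susceptibility: on a storage symbol of level `k - 1` or `k` the input head stays still,
and on the frozen blank the inner state is kept. -/
def DepthSusceptible (M : StorageAutomaton k α) : Prop :=
  (∀ q σ γ, (M.dv γ + 1 = k ∨ M.dv γ = k) → (M.δ q σ γ).inputDir = 0) ∧
  (∀ q σ, (M.δ q σ M.frozen).state = q)

/-- A (surface) configuration: inner state, positions of the input head and of the storage head,
content of the storage tape. -/
structure Cfg (M : StorageAutomaton k α) where
  state : M.Q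
  inputPos : ℕ
  storagePos : ℕ
  tape : ℕ → M.Γ

def init (M : StorageAutomaton k α) : M.Cfg :=
  ⟨M.start, 0, 0, Function.update (fun _ => M.blank) 0 M.leftEnd⟩

open Classical in
/-- One step on input `x`; a halting configuration is kept as it is. (The storage head never moves
left from cell `0`, which always holds the left endmarker, so `Int.toNat` does not truncate.) -/
noncomputable def step (M : StorageAutomaton k α) (x : List α) (c : M.Cfg) : M.Cfg :=
  if c.state ∈ M.acc ∪ M.rej then c
  else
    let m := M.δ c.state (inputCell x c.inputPos) (c.tape c.storagePos)
    { state := m.state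
      inputPos := c.inputPos + m.inputDir.val
      storagePos := ((c.storagePos : ℤ) + (m.storageDir : ℤ)).toNat
      tape := Function.update c.tape c.storagePos m.write }

/-- The configuration after `t` steps on input `x`. -/
noncomputable def run (M : StorageAutomaton k α) (x : List α) (t : ℕ) : M.Cfg :=
  (M.step x)^[t] M.init

def Accepts (M : StorageAutomaton k α) (x : List α) : Prop :=
  ∃ t, (M.run x t).state ∈ M.acc

def Rejects (M : StorageAutomaton k α) (x : List α) : Prop :=
  ∃ t, (M.run x t).state ∈ M.rej

/-- `M` recognizes `L`: it accepts every word of `L` and rejects every other word (so it halts on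
all inputs). -/
def Recognizes (M : StorageAutomaton k α) (L : Language α) : Prop :=
  (∀ x : List α, x ∈ L → M.Accepts x) ∧ (∀ x : List α, x ∉ L → M.Rejects x)

end StorageAutomaton

/-- The languages over `α` recognized by depth-susceptible depth-`k` storage automata. -/
def SDA (k : ℕ) (α : Type) : Set (Language α) :=
  {L | ∃ M : StorageAutomaton k α, M.DepthSusceptible ∧ M.Recognizes L}

/-- The union of `SDA k α` over all `k ≥ 1`. -/
def omegaSDA (α : Type) : Set (Language α) :=
  {L | ∃ k : ℕ, 1 ≤ k ∧ L ∈ SDA k α}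

/-!
The equality comes from two simulations, in which the storage tape of a depth-2 automaton is
read as a pushdown store.

*From storage automata to pushdown automata.* In depth 2 a symbol of level 1 is turned into the
frozen blank as soon as the storage head moves off it, and the head never leaves the leftmost blank
cell (the frontier) to the left without freezing that cell. Hence everything between the head and
the frontier is frozen, and what matters of the tape is the sequence of level-1 symbols left of the
head, a stack. A block of frozen blanks is traversed in a fixed state, so in a fixed direction, and
it is enough to know whether such a block is present (`Place`, `Represents.step`). The resulting
machine `EndmarkedPDA` may look at its input symbol without consuming it and sees the right
endmarker. Both abilities are removed in `EndmarkedPDA.toDPDA`: the current symbol is kept in the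
finite control, and each stack symbol carries the *profile* of the stack below it, the set of states
from which the machine would accept on the right endmarker. The profile of `X :: s` depends on `X`
and the profile of `s` only (`Eval.congr_profile`), so it can be maintained while pushing and
popping, and it tells in which states the automaton has to accept.

*From pushdown automata to storage automata.* The stack is kept as a sequence of level-1 symbols
below the frontier; a symbol is popped by freezing its cell. The storage automaton has to halt on
every input, whereas `ε`-runs of the pushdown automaton may be infinite. Therefore an `ε`-run is never
simulated move by move: for a state `p` and a top symbol `X` it is a property of `(p, X)` alone
whether the run pops `X` (`Pops`), or stops to read a letter (`Reads`), or does neither, and whether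
it visits a final state (`VisitsFinal`), and this information is built into the transition function.
Each simulated move then shortens the remaining input or the stack (`continues_acceptsFrom`).

*Depth `k` and depth `k + 1`.* The only symbol that depth `k + 1` may forbid a depth-`k` automaton to
write is the frozen blank; a copy of it, of level `k`, is written instead (`deepen`).
-/

/-! ### Runs of deterministic pushdown automata -/

namespace DPDA

variable {α : Type} {M : DPDA α}

/-- Acceptance from an arbitrary instantaneous description. -/
def AcceptsFrom (M : DPDA α) (c : M.Cfg) : Prop :=
  ∃ p ∈ M.final, ∃ s : List M.Γ, Relation.ReflTransGen M.Step c ⟨p, [], s⟩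

theorem Step.rightUnique : Relator.RightUnique M.Step := by
  intro a b c hab hac
  cases hab with
  | epsilon h =>
    cases hac with
    | epsilon h' => rw [h] at h'; cases h'; rfl
    | read h' => rw [M.deterministic _ _ (by rw [h]; simp)] at h'; cases h'
  | read h =>
    cases hac with
    | epsilon h' => rw [M.deterministic _ _ (by rw [h']; simp)] at h; cases h
    | read h' => rw [h] at h'; cases h'; rfl

/-- A configuration that is neither accepting nor stuck accepts iff its successor does. -/
theorem acceptsFrom_iff_of_step {c d : M.Cfg} (h : M.Step c d)
    (hc : c.state ∈ M.final → c.input ≠ []) : M.AcceptsFrom c ↔ M.AcceptsFrom d := by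
  constructor
  · rintro ⟨p, hp, s, hr⟩
    rcases hr.cases_head with rfl | ⟨e, he, hr⟩
    · exact absurd rfl (hc hp)
    · exact ⟨p, hp, s, Step.rightUnique h he ▸ hr⟩
  · rintro ⟨p, hp, s, hr⟩
    exact ⟨p, hp, s, hr.head h⟩

/-- A configuration without successors accepts iff it is accepting. -/
theorem acceptsFrom_iff_of_stuck {c : M.Cfg} (h : ∀ d, ¬ M.Step c d) :
    M.AcceptsFrom c ↔ c.state ∈ M.final ∧ c.input = [] := by
  constructor
  · rintro ⟨p, hp, s, hr⟩
    rcases hr.cases_head with rfl | ⟨e, he, -⟩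
    · exact ⟨hp, rfl⟩
    · exact absurd he (h e)
  · rintro ⟨hp, hi⟩
    obtain ⟨q, x, s⟩ := c
    obtain rfl : x = [] := hi
    exact ⟨q, hp, s, .refl⟩

theorem not_step_nil {q : M.Q} {x : List α} {d : M.Cfg} : ¬ M.Step ⟨q, x, []⟩ d := by
  intro h; cases h

/-- `M.EpsReach p u q v`: a (possibly empty) sequence of `ε`-moves leads from state `p` and stack
`u` to state `q` and stack `v`. On the empty input only `ε`-moves are possible. -/
def EpsReach (M : DPDA α) (p : M.Q) (u : List M.Γ) (q : M.Q) (v : List M.Γ) : Prop :=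
  Relation.ReflTransGen M.Step ⟨p, [], u⟩ ⟨q, [], v⟩

theorem EpsReach.reach {p q : M.Q} {u v : List M.Γ} (h : M.EpsReach p u q v) (x : List α)
    (s : List M.Γ) : Relation.ReflTransGen M.Step ⟨p, x, u ++ s⟩ ⟨q, x, v ++ s⟩ := by
  have key : ∀ c d : M.Cfg, Relation.ReflTransGen M.Step c d → c.input = [] →
      Relation.ReflTransGen M.Step ⟨c.state, x, c.stack ++ s⟩ ⟨d.state, x, d.stack ++ s⟩ := by
    intro c d h
    induction h using Relation.ReflTransGen.head_induction_on with
    | refl => intro _; exact .refl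
    | head h _ ih =>
      intro hc
      cases h with
      | epsilon h =>
        refine .head (.epsilon h) ?_
        simpa using ih hc
      | read h => cases hc
  exact key _ _ h rfl

/-- A run on the stack `u ++ s` either never looks at `s` or first removes `u` completely. -/
theorem EpsReach.split {p q : M.Q} {u s v : List M.Γ} (h : M.EpsReach p (u ++ s) q v) :
    (∃ u', v = u' ++ s ∧ M.EpsReach p u q u') ∨
      ∃ r, M.EpsReach p u r [] ∧ M.EpsReach r s q v := by
  have key : ∀ c d : M.Cfg, Relation.ReflTransGen M.Step c d → c.input = [] → d.input = [] →
      ∀ u, c.stack = u ++ s → (∃ u', d.stack = u' ++ s ∧ M.EpsReach c.state u d.state u') ∨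
      ∃ r, M.EpsReach c.state u r [] ∧ M.EpsReach r s d.state d.stack := by
    intro c d hcd
    induction hcd using Relation.ReflTransGen.head_induction_on with
    | refl => intro _ _ u hu; exact .inl ⟨u, hu, .refl⟩
    | head hs hr ih =>
      intro hc hd u hu
      cases hs with
      | epsilon he =>
        cases hc
        rcases u with _ | ⟨Y, u⟩
        · refine .inr ⟨_, .refl, ?_⟩
          rw [List.nil_append] at hu
          subst hu
          obtain ⟨a, b, c⟩ := d
          cases hd
          exact .head (.epsilon he) hr
        · cases hu
          rcases ih rfl hd (_ ++ u) (List.append_assoc ..).symm with ⟨u', h1, h2⟩ | ⟨r, h1, h2⟩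
          · exact .inl ⟨u', h1, .head (.epsilon he) h2⟩
          · exact .inr ⟨r, .head (.epsilon he) h1, h2⟩
      | read he => cases hc
  exact key _ _ h rfl rfl u rfl

/-- Two `ε`-runs that cannot be prolonged end in the same configuration. -/
theorem EpsReach.unique {p q q' : M.Q} {u v v' : List M.Γ} (h : M.EpsReach p u q v)
    (h' : M.EpsReach p u q' v') (hv : ∀ d, ¬ M.Step ⟨q, [], v⟩ d)
    (hv' : ∀ d, ¬ M.Step ⟨q', [], v'⟩ d) : q = q' ∧ v = v' := by
  have : (⟨q, [], v⟩ : M.Cfg) = ⟨q', [], v'⟩ := by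
    rcases Relation.ReflTransGen.total_of_right_unique Step.rightUnique h h' with h | h
    · rcases h.cases_head with h | ⟨e, he, -⟩
      · exact h
      · exact absurd he (hv e)
    · rcases h.cases_head with h | ⟨e, he, -⟩
      · exact h.symm
      · exact absurd he (hv' e)
  cases this
  exact ⟨rfl, rfl⟩

/-- `M.Pops p X q`: started in state `p` with `X` on top, `M` removes `X` (and everything it has put
in place of it) by `ε`-moves, arriving in state `q`. -/
def Pops (M : DPDA α) (p : M.Q) (X : M.Γ) (q : M.Q) : Prop := M.EpsReach p [X] q []

/-- `M.Reads p X a q w`: started in state `p` with `X` on top, `M` makes some `ε`-moves that never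
look below `X` and then consumes `a`, arriving in state `q` with `w` in place of `X`. -/
def Reads (M : DPDA α) (p : M.Q) (X : M.Γ) (a : α) (q : M.Q) (w : List M.Γ) : Prop :=
  ∃ r Y t v, M.EpsReach p [X] r (Y :: t) ∧ M.δ r (some a) Y = some (q, v) ∧ w = v ++ t

/-- `M.VisitsFinal p X`: started in state `p` with `X` on top, `M` passes through a final state by
`ε`-moves that never look below `X`. -/
def VisitsFinal (M : DPDA α) (p : M.Q) (X : M.Γ) : Prop :=
  ∃ q ∈ M.final, ∃ s, M.EpsReach p [X] q s

theorem Pops.unique {p q q' : M.Q} {X : M.Γ} (h : M.Pops p X q) (h' : M.Pops p X q') : q = q' :=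
  (EpsReach.unique h h' (fun _ => not_step_nil) (fun _ => not_step_nil)).1

theorem not_step_of_read {r q : M.Q} {a : α} {Y : M.Γ} {v t : List M.Γ}
    (h : M.δ r (some a) Y = some (q, v)) (d : M.Cfg) : ¬ M.Step ⟨r, [], Y :: t⟩ d := by
  intro hs
  cases hs with
  | epsilon h' => rw [M.deterministic _ _ (by rw [h']; simp)] at h; cases h

theorem Reads.unique {p q q' : M.Q} {X : M.Γ} {a : α} {w w' : List M.Γ}
    (h : M.Reads p X a q w) (h' : M.Reads p X a q' w') : q = q' ∧ w = w' := by
  obtain ⟨r, Y, t, v, h1, h2, rfl⟩ := h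
  obtain ⟨r', Y', t', v', h1', h2', rfl⟩ := h'
  obtain ⟨rfl, h⟩ := h1.unique h1' (not_step_of_read h2) (not_step_of_read h2')
  cases h
  rw [h2] at h2'
  cases h2'
  exact ⟨rfl, rfl⟩

theorem Reads.not_pops {p q q' : M.Q} {X : M.Γ} {a : α} {w : List M.Γ}
    (h : M.Reads p X a q w) : ¬ M.Pops p X q' := by
  obtain ⟨r, Y, t, v, h1, h2, rfl⟩ := h
  intro h'
  obtain ⟨-, h⟩ := h1.unique h' (not_step_of_read h2) (fun _ => not_step_nil)
  cases h

theorem acceptsFrom_empty {p : M.Q} {x : List α} :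
    M.AcceptsFrom ⟨p, x, []⟩ ↔ p ∈ M.final ∧ x = [] :=
  acceptsFrom_iff_of_stuck fun _ => not_step_nil

/-- Acceptance at the end of the input, in terms of the top symbol alone. -/
theorem acceptsFrom_nil {p : M.Q} {X : M.Γ} {s : List M.Γ} :
    M.AcceptsFrom ⟨p, [], X :: s⟩ ↔
      M.VisitsFinal p X ∨ ∃ q, M.Pops p X q ∧ M.AcceptsFrom ⟨q, [], s⟩ := by
  constructor
  · rintro ⟨q, hq, t, h⟩
    rcases EpsReach.split (u := [X]) (s := s) h with ⟨u', -, h⟩ | ⟨r, h1, h2⟩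
    · exact .inl ⟨q, hq, u', h⟩
    · exact .inr ⟨r, h1, q, hq, t, h2⟩
  · rintro (⟨q, hq, t, h⟩ | ⟨q, h, r, hr, t, h'⟩)
    · exact ⟨q, hq, _, h.reach [] s⟩
    · exact ⟨r, hr, t, (h.reach [] s).trans h'⟩

/-- Acceptance when some input is left, in terms of the top symbol alone. -/
theorem acceptsFrom_cons {p : M.Q} {a : α} {x : List α} {X : M.Γ} {s : List M.Γ} :
    M.AcceptsFrom ⟨p, a :: x, X :: s⟩ ↔
      (∃ q w, M.Reads p X a q w ∧ M.AcceptsFrom ⟨q, x, w ++ s⟩) ∨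
        ∃ q, M.Pops p X q ∧ M.AcceptsFrom ⟨q, a :: x, s⟩ := by
  -- the whole run is an `ε`-run followed by the move that consumes `a`
  have key : ∀ c d : M.Cfg, Relation.ReflTransGen M.Step c d → c.input = a :: x → d.input = [] →
      ∃ r Y t q v, M.EpsReach c.state c.stack r (Y :: t) ∧ M.δ r (some a) Y = some (q, v) ∧
        Relation.ReflTransGen M.Step ⟨q, x, v ++ t⟩ d := by
    intro c d h
    induction h using Relation.ReflTransGen.head_induction_on with
    | refl => intro h h'; rw [h] at h'; cases h'
    | head h hr ih =>
      intro hc hd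
      cases h with
      | epsilon h =>
        obtain ⟨r, Y, t, q, v, h1, h2, h3⟩ := ih hc hd
        exact ⟨r, Y, t, q, v, .head (.epsilon h) h1, h2, h3⟩
      | read h =>
        cases hc
        exact ⟨_, _, _, _, _, .refl, h, hr⟩
  constructor
  · rintro ⟨f, hf, t, h⟩
    obtain ⟨r, Y, t', q, v, h1, h2, h3⟩ := key _ _ h rfl rfl
    rcases EpsReach.split (u := [X]) (s := s) h1 with ⟨u', h4, h5⟩ | ⟨r', h4, h5⟩
    · rcases u' with _ | ⟨Z, u'⟩
      · refine .inr ⟨r, h5, f, hf, t, ?_⟩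
        obtain rfl : Y :: t' = s := h4
        exact .head (.read h2) h3
      · cases h4
        refine .inl ⟨q, v ++ u', ⟨r, Y, u', v, h5, h2, rfl⟩, f, hf, t, ?_⟩
        rwa [List.append_assoc]
    · refine .inr ⟨r', h4, f, hf, t, ?_⟩
      have := h5.reach (a :: x) []
      simp only [List.append_nil] at this
      exact this.trans (.head (.read h2) h3)
  · rintro (⟨q, w, ⟨r, Y, t, v, h1, h2, rfl⟩, f, hf, t', h⟩ | ⟨q, h, f, hf, t, h'⟩)
    · refine ⟨f, hf, t', (h1.reach (a :: x) s).trans (.head (.read h2) ?_)⟩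
      rw [List.append_assoc] at h
      exact h
    · exact ⟨f, hf, t, (h.reach (a :: x) s).trans h'⟩

end DPDA

/-! ### Removing lookahead and the right endmarker -/

/-- A deterministic pushdown machine that looks at its current input symbol before consuming it and
that can see the right endmarker. A move `τ q σ X = (p, b, w)` replaces the top symbol `X` by `w`
and advances to the next input symbol iff `b`. The machine stops as soon as it is in a state of
`acc` or `rej`. -/
structure EndmarkedPDA (α : Type) where
  Q : Type
  Γ : Type
  finite_Q : Finite Q
  finite_Γ : Finite Γ
  τ : Q → InputSymbol α → Γ → Q × Bool × List Γ
  start : Q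
  bottom : Γ
  acc : Set Q
  rej : Set Q
  disjoint : Disjoint acc rej

instance {α : Type} [Finite α] : Finite (InputSymbol α) :=
  Finite.of_surjective
    (fun o : Option (Option α) => match o with
      | none => .leftEnd
      | some none => .rightEnd
      | some (some a) => .letter a)
    (fun σ => match σ with
      | .leftEnd => ⟨none, rfl⟩
      | .rightEnd => ⟨some none, rfl⟩
      | .letter a => ⟨some (some a), rfl⟩)

namespace EndmarkedPDA

variable {α : Type} (P : EndmarkedPDA α)

/-- The input symbol scanned after an optional advance, `r` being the word to the right of the
scanned symbol. -/
def nextSymbol (b : Bool) (σ : InputSymbol α) (r : List α) : InputSymbol α :=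
  match b, r with
  | false, _ => σ
  | true, [] => .rightEnd
  | true, a :: _ => .letter a

/-- The word to the right of the scanned symbol after an optional advance. -/
def nextRest (b : Bool) (r : List α) : List α :=
  if b then r.tail else r

/-- `P.Eval q σ r s b`: started in state `q` on the scanned symbol `σ`, with `r` to its right and
with stack `s`, the machine accepts (`b = true`) or rejects (`b = false`) after finitely many
moves. -/
inductive Eval : P.Q → InputSymbol α → List α → List P.Γ → Bool → Prop
  | acc {q σ r s} : q ∈ P.acc → s ≠ [] → Eval q σ r s true
  | rej {q σ r s} : q ∈ P.rej → Eval q σ r s false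
  | step {q σ r X s b} : q ∉ P.acc → q ∉ P.rej →
      Eval (P.τ q σ X).1 (nextSymbol (P.τ q σ X).2.1 σ r) (nextRest (P.τ q σ X).2.1 r)
        ((P.τ q σ X).2.2 ++ s) b → Eval q σ r (X :: s) b

variable {P}

theorem Eval.unique {q : P.Q} {σ : InputSymbol α} {r : List α} {s : List P.Γ} {b b' : Bool}
    (h : P.Eval q σ r s b) (h' : P.Eval q σ r s b') : b = b' := by
  induction h with
  | acc h1 _ =>
    cases h' with
    | acc => rfl
    | rej h2 => exact absurd h2 (P.disjoint.notMem_of_mem_left h1)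
    | step h2 => exact absurd h1 h2
  | rej h1 =>
    cases h' with
    | acc h2 => exact absurd h1 (P.disjoint.notMem_of_mem_left h2)
    | rej h2 => rfl
    | step _ h2 => exact absurd h1 h2
  | step h1 h2 _ ih =>
    cases h' with
    | acc h => exact absurd h h1
    | rej h => exact absurd h h2
    | step _ _ h => exact ih h

theorem Eval.eq_false {q : P.Q} {σ : InputSymbol α} {r : List α} {b : Bool}
    (h : P.Eval q σ r [] b) : b = false := by
  cases h with
  | acc _ h => exact absurd rfl h
  | rej => rfl

variable (P) in
/-- The states from which the machine, scanning the right endmarker, accepts with stack `s`. -/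
def profile (s : List P.Γ) : Set P.Q :=
  {q | P.Eval q .rightEnd [] s true}

theorem Eval.congr_profile {u s s' : List P.Γ} {q : P.Q}
    (hs : P.profile s ⊆ P.profile s') (h : P.Eval q .rightEnd [] (u ++ s) true) :
    P.Eval q .rightEnd [] (u ++ s') true := by
  generalize hσ : InputSymbol.rightEnd = σ at h
  generalize hr : ([] : List α) = r at h
  generalize ht : u ++ s = t at h
  generalize hb : true = b at h
  induction h generalizing u with
  | @acc q σ r t h1 h2 =>
    subst hσ hr
    rcases u with _ | ⟨X, u⟩
    · rw [List.nil_append] at ht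
      subst ht
      exact hs (Eval.acc h1 h2)
    · exact .acc h1 (by simp)
  | rej => cases hb
  | @step q σ r X t b h1 h2 h3 ih =>
    subst hσ hr hb
    rcases u with _ | ⟨Y, u⟩
    · rw [List.nil_append] at ht
      subst ht
      exact hs (Eval.step h1 h2 h3)
    · cases ht
      have e1 : (InputSymbol.rightEnd : InputSymbol α) =
          nextSymbol (P.τ q .rightEnd X).2.1 .rightEnd [] := by
        cases (P.τ q .rightEnd X).2.1 <;> rfl
      have e2 : [] = nextRest (P.τ q .rightEnd X).2.1 ([] : List α) := by
        cases (P.τ q .rightEnd X).2.1 <;> rfl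
      have := ih (u := (P.τ q .rightEnd X).2.2 ++ u) e1 e2 (by simp) rfl
      refine .step h1 h2 ?_
      rwa [List.append_assoc] at this

variable (P) in
/-- The profile of `X :: s` as a function of `X` and of the profile of `s`; well defined by
`Eval.congr_profile`. -/
def extend (X : P.Γ) (A : Set P.Q) : Set P.Q :=
  {q | ∃ s, P.profile s = A ∧ q ∈ P.profile (X :: s)}

theorem extend_profile (X : P.Γ) (s : List P.Γ) :
    P.extend X (P.profile s) = P.profile (X :: s) := by
  ext q
  constructor
  · rintro ⟨s', h, hq⟩
    exact Eval.congr_profile (u := [X]) h.subset hq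
  · intro h
    exact ⟨s, rfl, h⟩

variable (P) in
/-- The word `w`, each symbol being paired with the profile of the stack below it, where `A` is the
profile of the stack below `w`. -/
def annotate (A : Set P.Q) : List P.Γ → List (P.Γ × Set P.Q)
  | [] => []
  | X :: w => (X, w.foldr P.extend A) :: annotate A w

theorem foldr_extend (w s : List P.Γ) :
    w.foldr P.extend (P.profile s) = P.profile (w ++ s) := by
  induction w with
  | nil => rfl
  | cons X w ih => rw [List.foldr_cons, ih, extend_profile, List.cons_append]

theorem annotate_append (w s : List P.Γ) :
    P.annotate (P.profile []) (w ++ s) =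
      P.annotate (P.profile s) w ++ P.annotate (P.profile []) s := by
  induction w with
  | nil => rfl
  | cons X w ih =>
    have h := foldr_extend (w ++ s) []
    rw [List.append_nil] at h
    simp only [annotate, List.cons_append, ih, foldr_extend, h]

variable (P) in
/-- States of the pushdown automaton without endmarkers. In `run q σ` the symbol `σ` has been
consumed; in `wait q A` the next symbol is needed, and `A` is the profile of the current stack. -/
inductive Control where
  | run : P.Q → InputSymbol α → Control
  | wait : P.Q → Set P.Q → Control
  | accepted : Control

instance [Finite α] : Finite P.Control := by
  have := P.finite_Q
  refine Finite.of_surjective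
    (fun o : Option (P.Q × InputSymbol α ⊕ P.Q × Set P.Q) => match o with
      | none => .accepted
      | some (.inl a) => .run a.1 a.2
      | some (.inr a) => .wait a.1 a.2) ?_
  rintro (⟨q, σ⟩ | ⟨q, A⟩ | _)
  · exact ⟨some (.inl (q, σ)), rfl⟩
  · exact ⟨some (.inr (q, A)), rfl⟩
  · exact ⟨none, rfl⟩

open Classical in
variable (P) in
/-- The transition function of the automaton without endmarkers. -/
noncomputable def toDPDAStep :
    P.Control → Option α → P.Γ × Set P.Q → Option (P.Control × List (P.Γ × Set P.Q))
  | .run q σ, none, (X, A) =>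
    if q ∈ P.acc then some (.accepted, [(X, A)])
    else if q ∈ P.rej then none
    else some (if (P.τ q σ X).2.1 then .wait (P.τ q σ X).1 ((P.τ q σ X).2.2.foldr P.extend A)
      else .run (P.τ q σ X).1 σ, P.annotate A (P.τ q σ X).2.2)
  | .wait q _, some a, Z => some (.run q (.letter a), [Z])
  | .accepted, some _, Z => some (.accepted, [Z])
  | _, _, _ => none

variable (P) in
/-- The pushdown automaton without endmarkers: it keeps the profile of the stack up to date, so that
whenever it needs the next symbol it knows whether `P` would accept on the right endmarker. -/
noncomputable def toDPDA [Finite α] : DPDA α where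
  Q := P.Control
  Γ := P.Γ × Set P.Q
  finite_Q := inferInstance
  finite_Γ := by
    have := P.finite_Q
    have := P.finite_Γ
    infer_instance
  δ := P.toDPDAStep
  start := .run P.start .leftEnd
  bottom := (P.bottom, P.profile [])
  final := {c | match c with
    | .run _ _ => False
    | .wait q A => q ∈ A
    | .accepted => True}
  deterministic := by
    rintro (⟨q, σ⟩ | ⟨q, A⟩ | _) ⟨X, B⟩ h a
    · rfl
    · exact absurd rfl h
    · exact absurd rfl h

variable [Finite α]

variable (P) in
/-- Configurations of `P.toDPDA`. -/
def cfg (c : P.Control) (r : List α) (s : List (P.Γ × Set P.Q)) : P.toDPDA.Cfg := ⟨c, r, s⟩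

theorem run_notMem_final {q : P.Q} {σ : InputSymbol α} : Control.run q σ ∉ P.toDPDA.final := id

theorem cfg_step_epsilon {c d : P.Control} {r : List α} {Z : P.Γ × Set P.Q}
    {s w : List (P.Γ × Set P.Q)} (h : P.toDPDAStep c none Z = some (d, w)) :
    P.toDPDA.Step (P.cfg c r (Z :: s)) (P.cfg d r (w ++ s)) :=
  .epsilon h

theorem cfg_step_read {c d : P.Control} {r : List α} {a : α} {Z : P.Γ × Set P.Q}
    {s w : List (P.Γ × Set P.Q)} (h : P.toDPDAStep c (some a) Z = some (d, w)) :
    P.toDPDA.Step (P.cfg c (a :: r) (Z :: s)) (P.cfg d r (w ++ s)) :=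
  .read h

theorem not_step_cfg {c : P.Control} {r : List α} {s : List (P.Γ × Set P.Q)}
    (h : ∀ Z t, s = Z :: t →
      P.toDPDAStep c none Z = none ∧ ∀ a, a ∈ r → P.toDPDAStep c (some a) Z = none)
    (d : P.toDPDA.Cfg) : ¬ P.toDPDA.Step (P.cfg c r s) d := by
  intro hd
  generalize he : P.cfg c r s = e at hd
  cases hd with
  | epsilon h' =>
    cases he
    exact absurd ((h _ _ rfl).1.symm.trans h') (by simp)
  | read h' =>
    cases he
    exact absurd (((h _ _ rfl).2 _ List.mem_cons_self).symm.trans h') (by simp)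

theorem acceptsFrom_accepted (r : List α) (Z : P.Γ × Set P.Q) (s : List (P.Γ × Set P.Q)) :
    P.toDPDA.AcceptsFrom (P.cfg .accepted r (Z :: s)) := by
  refine ⟨Control.accepted, trivial, Z :: s, ?_⟩
  induction r with
  | nil => exact .refl
  | cons a r ih => exact .head (cfg_step_read (w := [Z]) rfl) ih

theorem acceptsFrom_wait_nil {q : P.Q} {A : Set P.Q} {s : List (P.Γ × Set P.Q)} :
    P.toDPDA.AcceptsFrom (P.cfg (.wait q A) [] s) ↔ q ∈ A := by
  rw [DPDA.acceptsFrom_iff_of_stuck (not_step_cfg fun Z t _ => ⟨rfl, by simp⟩)]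
  exact ⟨fun h => h.1, fun h => ⟨h, rfl⟩⟩

theorem acceptsFrom_wait_cons {q : P.Q} {A : Set P.Q} {a : α} {r : List α} {Z : P.Γ × Set P.Q}
    {s : List (P.Γ × Set P.Q)} :
    P.toDPDA.AcceptsFrom (P.cfg (.wait q A) (a :: r) (Z :: s)) ↔
      P.toDPDA.AcceptsFrom (P.cfg (.run q (.letter a)) r (Z :: s)) :=
  DPDA.acceptsFrom_iff_of_step (cfg_step_read (w := [Z]) rfl) (fun _ h => by cases h)

theorem not_acceptsFrom_empty {c : P.Control} {a : α} {r : List α} :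
    ¬ P.toDPDA.AcceptsFrom (P.cfg c (a :: r) []) := by
  rw [DPDA.acceptsFrom_iff_of_stuck (not_step_cfg fun Z t h => by cases h)]
  exact fun h => by cases h.2

/-- The automaton without endmarkers accepts iff the verdict of `P` is positive. -/
theorem Eval.acceptsFrom_iff {q : P.Q} {σ : InputSymbol α} {r : List α} {s : List P.Γ} {b : Bool}
    (h : P.Eval q σ r s b) (hσ : σ ≠ .rightEnd) :
    P.toDPDA.AcceptsFrom (P.cfg (.run q σ) r (P.annotate (P.profile []) s)) ↔ b = true := by
  have prof : ∀ s : List P.Γ, s.foldr P.extend (P.profile []) = P.profile s := fun s => by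
    rw [foldr_extend, List.append_nil]
  induction h with
  | @acc q σ r s h1 h2 =>
    obtain ⟨X, s, rfl⟩ := List.exists_cons_of_ne_nil h2
    refine iff_of_true ?_ rfl
    have hstep : P.toDPDAStep (.run q σ) none (X, s.foldr P.extend (P.profile [])) =
        some (.accepted, [(X, s.foldr P.extend (P.profile []))]) := if_pos h1
    rw [annotate, DPDA.acceptsFrom_iff_of_step (cfg_step_epsilon hstep)
      (absurd · run_notMem_final)]
    exact acceptsFrom_accepted ..
  | @rej q σ r s h1 =>
    refine iff_of_false ?_ (by simp)
    rw [DPDA.acceptsFrom_iff_of_stuck (not_step_cfg fun Z t _ => ⟨?_, fun _ _ => rfl⟩)]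
    · exact fun h => run_notMem_final h.1
    · exact (if_neg (P.disjoint.notMem_of_mem_right h1)).trans (if_pos h1)
  | @step q σ r X s b h1 h2 h3 ih =>
    have hstep : P.toDPDAStep (.run q σ) none (X, P.profile s) =
        some (if (P.τ q σ X).2.1 then
            .wait (P.τ q σ X).1 ((P.τ q σ X).2.2.foldr P.extend (P.profile s))
          else .run (P.τ q σ X).1 σ, P.annotate (P.profile s) (P.τ q σ X).2.2) :=
      (if_neg h1).trans (if_neg h2)
    rw [annotate, prof, DPDA.acceptsFrom_iff_of_step (cfg_step_epsilon hstep)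
      (absurd · run_notMem_final),
      ← annotate_append, foldr_extend]
    rcases hb : (P.τ q σ X).2.1 with _ | _
    · simp only [hb, nextSymbol, nextRest] at ih
      exact ih hσ
    · simp only [hb, nextRest, if_true] at ih h3
      rw [if_pos rfl]
      cases r with
      | nil =>
        rw [acceptsFrom_wait_nil]
        constructor
        · exact fun h => h3.unique h
        · rintro rfl
          exact h3
      | cons a r =>
        simp only [nextSymbol, List.tail_cons] at ih h3
        generalize (P.τ q σ X).2.2 ++ s = t at *
        cases t with
        | nil =>
          rw [h3.eq_false]
          exact iff_of_false not_acceptsFrom_empty (by simp)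
        | cons Y t =>
          exact acceptsFrom_wait_cons.trans (ih (by simp))

variable (P) in
theorem toDPDA_accepts_iff {x : List α} {b : Bool}
    (h : P.Eval P.start .leftEnd x [P.bottom] b) : P.toDPDA.Accepts x ↔ b = true :=
  h.acceptsFrom_iff (by simp)

end EndmarkedPDA

/-! ### Depth-2 storage automata as pushdown machines -/

namespace StorageAutomaton

variable {k : ℕ} {α : Type} (M : StorageAutomaton k α)

theorem frozen_level : M.dv M.frozen = k := (M.dv_eq_top _).2 (.inr rfl)

theorem leftEnd_level : M.dv M.leftEnd = k := (M.dv_eq_top _).2 (.inl rfl)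

theorem eq_frozen {γ : M.Γ} (h : M.dv γ = k) (h' : γ ≠ M.leftEnd) : γ = M.frozen :=
  ((M.dv_eq_top _).1 h).resolve_left h'

theorem inputCell_add (x : List α) (i : ℕ) (d : Fin 2) :
    inputCell x (i + d.val) =
      EndmarkedPDA.nextSymbol (d = 1) (inputCell x i) (x.drop i) := by
  match d with
  | 0 => rfl
  | 1 =>
    simp only [inputCell, decide_true]
    rcases h : x.drop i with _ | ⟨a, r⟩
    · have : x[i]? = none := by simpa using h
      simp [this, EndmarkedPDA.nextSymbol]
    · have : x[i]? = some a := by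
        have := congrArg List.head? h
        simpa using this
      simp [this, EndmarkedPDA.nextSymbol]

theorem drop_add (x : List α) (i : ℕ) (d : Fin 2) :
    x.drop (i + d.val) = EndmarkedPDA.nextRest (d = 1) (x.drop i) := by
  match d with
  | 0 => rfl
  | 1 => simp [EndmarkedPDA.nextRest]

variable {M} in
theorem step_of_not_halted {x : List α} {c : M.Cfg}
    (hacc : c.state ∉ M.acc) (hrej : c.state ∉ M.rej) :
    M.step x c =
      let m := M.δ c.state (inputCell x c.inputPos) (c.tape c.storagePos)
      ⟨m.state, c.inputPos + m.inputDir.val,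
        ((c.storagePos : ℤ) + (m.storageDir : ℤ)).toNat,
        Function.update c.tape c.storagePos m.write⟩ :=
  if_neg (by rintro (h | h) <;> contradiction)

section DepthTwo

variable {α : Type} (M : StorageAutomaton 2 α)

/-- The position of the storage head relative to the topmost non-`B` cell (the "top") and the
leftmost blank cell (the "frontier"): on the frontier, on a `B` strictly between the two, or on the
top. The Boolean of `front` and of `top` says whether there is a `B` between top and frontier. -/
inductive Place where
  | front : Bool → Place
  | gap : Place
  | top : Bool → Place

instance : Finite Place :=
  Finite.of_surjective
    (fun o : Option (Bool ⊕ Bool) => match o with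
      | none => .gap
      | some (.inl b) => .front b
      | some (.inr b) => .top b)
    (by
      rintro (b | _ | b)
      · exact ⟨some (.inl b), rfl⟩
      · exact ⟨none, rfl⟩
      · exact ⟨some (.inr b), rfl⟩)

/-- The place reached by stepping left, where `b` says whether the cell there holds `B`. -/
def Place.leftwards (b : Bool) : Place := if b then .gap else .top true

open Classical in
/-- The transition function of the pushdown machine that simulates `M`. Its stack holds the non-`B`
cells left of the frontier, each with a Boolean saying whether the cell on its left holds `B`. All
moves of `M` through a block of `B`s are one move of the machine.The head is on the top with no
`B` to its right only before it first leaves the left endmarker. -/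
noncomputable def pdaMove : M.Q × Place → InputSymbol α → M.Γ × Bool →
    (M.Q × Place) × Bool × List (M.Γ × Bool)
  | (q, .front b), σ, X =>
    let m := M.δ q σ M.blank
    match m.storageDir with
    | .zero => ((m.state, .front b), m.inputDir = 1, [X])
    | .pos => ((m.state, .front false), m.inputDir = 1, [(m.write, b), X])
    | .neg => ((m.state, .leftwards b), m.inputDir = 1, [X])
  | (q, .gap), σ, X =>
    match (M.δ q σ M.frozen).storageDir with
    | .zero => ((q, .gap), false, [X])
    | .pos => ((q, .front true), false, [X])
    | .neg => ((q, .top true), false, [X])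
  | (q, .top b), σ, X =>
    let m := M.δ q σ X.1
    match m.storageDir with
    | .zero => ((m.state, .top b), m.inputDir = 1, [X])
    | .pos =>
      if X.1 = M.leftEnd then ((m.state, if b then .gap else .front false), m.inputDir = 1, [X])
      else ((m.state, .gap), m.inputDir = 1, [])
    | .neg => ((m.state, .leftwards X.2), m.inputDir = 1, [])

/-- The pushdown machine that simulates `M`. -/
noncomputable def toEndmarkedPDA : EndmarkedPDA α where
  Q := M.Q × Place
  Γ := M.Γ × Bool
  finite_Q := by
    have := M.finite_Q
    infer_instance
  finite_Γ := by
    have := M.finite_Γ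
    infer_instance
  τ := M.pdaMove
  start := (M.start, .top false)
  bottom := (M.leftEnd, false)
  acc := {p | p.1 ∈ M.acc}
  rej := {p | p.1 ∈ M.rej}
  disjoint := M.acc_rej_disjoint.preimage Prod.fst

open Classical in
/-- The stack that the first `h` cells of a storage tape stand for. -/
noncomputable def stackOf (t : ℕ → M.Γ) : ℕ → List (M.Γ × Bool)
  | 0 => []
  | h + 1 => if t h = M.frozen then stackOf t h
    else (t h, t (h - 1) = M.frozen) :: stackOf t h

theorem stackOf_congr {t t' : ℕ → M.Γ} {h : ℕ} (H : ∀ i < h, t i = t' i) :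
    M.stackOf t h = M.stackOf t' h := by
  induction h with
  | zero => rfl
  | succ h ih =>
    rw [stackOf, stackOf, H h (by omega), H (h - 1) (by omega), ih fun i hi => H i (by omega)]

/-- The tape `t` has its frontier at cell `n`. -/
structure IsFrontier (t : ℕ → M.Γ) (n : ℕ) : Prop where
  pos : 0 < n
  zero : t 0 = M.leftEnd
  left : ∀ i, 0 < i → i < n → t i ≠ M.leftEnd ∧ t i ≠ M.blank
  right : ∀ i, n ≤ i → t i = M.blank

/-- On the tape `t` with frontier `n`, the storage head on cell `h` is at the given place, and the
part of the tape that matters stands for the given stack. -/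
def Located (t : ℕ → M.Γ) (n h : ℕ) : Place → List (M.Γ × Bool) → Prop
  | .front b, s => h = n ∧ s = M.stackOf t n ∧ (b = true ↔ t (n - 1) = M.frozen)
  | .gap, s => h < n ∧ (∀ i, h ≤ i → i < n → t i = M.frozen) ∧ s = M.stackOf t h
  | .top b, s => h < n ∧ t h ≠ M.frozen ∧ (∀ i, h < i → i < n → t i = M.frozen) ∧
      s = M.stackOf t (h + 1) ∧ (b = true ↔ h + 1 < n) ∧ (h ≠ 0 → b = true)

variable {M}

theorem IsFrontier.update_frontier {t : ℕ → M.Γ} {n : ℕ} (ht : M.IsFrontier t n) {W : M.Γ}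
    (h1 : W ≠ M.leftEnd) (h2 : W ≠ M.blank) : M.IsFrontier (Function.update t n W) (n + 1) where
  pos := by omega
  zero := by rw [Function.update_of_ne ht.pos.ne, ht.zero]
  left i hi hi' := by
    rcases eq_or_ne i n with rfl | hne
    · rw [Function.update_self]; exact ⟨h1, h2⟩
    · rw [Function.update_of_ne hne]; exact ht.left i hi (by omega)
  right i hi := by rw [Function.update_of_ne (by omega)]; exact ht.right i (by omega)

theorem IsFrontier.update_inner {t : ℕ → M.Γ} {n h : ℕ} (ht : M.IsFrontier t n) (hh : 0 < h)
    (hn : h < n) {W : M.Γ} (h1 : W ≠ M.leftEnd) (h2 : W ≠ M.blank) :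
    M.IsFrontier (Function.update t h W) n where
  pos := ht.pos
  zero := by rw [Function.update_of_ne hh.ne, ht.zero]
  left i hi hi' := by
    rcases eq_or_ne i h with rfl | hne
    · rw [Function.update_self]; exact ⟨h1, h2⟩
    · rw [Function.update_of_ne hne]; exact ht.left i hi (by omega)
  right i hi := by rw [Function.update_of_ne (by omega)]; exact ht.right i (by omega)

open Classical in
theorem located_leftwards {t : ℕ → M.Γ} {n h : ℕ} (hn : h + 1 < n)
    (hB : ∀ i, h < i → i < n → t i = M.frozen) :
    M.Located t n h (.leftwards (t h = M.frozen)) (M.stackOf t (h + 1)) := by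
  by_cases hf : t h = M.frozen
  · simp only [hf, decide_true, Place.leftwards, if_true]
    refine ⟨by omega, fun i hi hi' => ?_, by rw [stackOf, if_pos hf]⟩
    rcases hi.eq_or_lt with rfl | hi
    · exact hf
    · exact hB i hi hi'
  · simp only [hf, decide_false, Place.leftwards]
    exact ⟨by omega, hf, hB, rfl, by simpa using hn, fun _ => rfl⟩

theorem frozen_ne_blank : M.frozen ≠ M.blank := by
  intro h
  have := (M.dv_eq_zero _).2 h
  rw [frozen_level] at this
  omega

theorem blank_level : M.dv M.blank = 0 := (M.dv_eq_zero _).2 rfl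

theorem blank_ne_leftEnd : M.blank ≠ M.leftEnd := by
  intro h
  have := (M.dv_eq_zero _).2 h.symm
  rw [leftEnd_level] at this
  omega

theorem level_one {γ : M.Γ} (h0 : γ ≠ M.blank) (h1 : γ ≠ M.leftEnd) (h2 : γ ≠ M.frozen) :
    M.dv γ = 1 := by
  have := M.dv_le γ
  have h0 := mt (M.dv_eq_zero γ).1 h0
  have h2 := mt (M.dv_eq_top γ).1 (not_or.2 ⟨h1, h2⟩)
  omega

theorem write_blank_pos {q : M.Q} {σ : InputSymbol α} (h : (M.δ q σ M.blank).storageDir = .pos) :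
    (M.δ q σ M.blank).write ≠ M.leftEnd ∧ (M.δ q σ M.blank).write ≠ M.blank ∧
      (M.δ q σ M.blank).write ≠ M.frozen := by
  have hd := M.depth_pass q σ M.blank (by rw [blank_level]; omega) (by rw [h, blank_level]; rfl)
  rw [blank_level] at hd
  refine ⟨fun h => ?_, fun h => ?_, fun h => ?_⟩ <;> rw [h] at hd
  · rw [leftEnd_level] at hd; omega
  · rw [blank_level] at hd; omega
  · rw [frozen_level] at hd; omega

theorem write_blank_neg {q : M.Q} {σ : InputSymbol α} (h : (M.δ q σ M.blank).storageDir = .neg) :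
    (M.δ q σ M.blank).write = M.frozen := by
  have hd := M.depth_turn q σ M.blank (by rw [blank_level]; omega) (by rw [h, blank_level]; rfl)
  rw [blank_level] at hd
  exact M.eq_frozen hd (M.leftEnd_not_written _ _ _ blank_ne_leftEnd)

theorem write_level_one {q : M.Q} {σ : InputSymbol α} {γ : M.Γ} (hγ : M.dv γ = 1)
    (h : (M.δ q σ γ).storageDir ≠ .zero) : (M.δ q σ γ).write = M.frozen := by
  have hl : γ ≠ M.leftEnd := by rintro rfl; rw [leftEnd_level] at hγ; omega
  refine M.eq_frozen ?_ (M.leftEnd_not_written _ _ _ hl)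
  rcases hd : (M.δ q σ γ).storageDir with _ | _ | _
  · exact absurd hd h
  · have := M.depth_pass q σ γ (by omega) (by rw [hd, hγ]; rfl)
    rw [this, hγ]; rfl
  · have := M.depth_turn q σ γ (by omega) (by rw [hd, hγ]; rfl)
    rw [this, hγ]; rfl

theorem stackOf_ne_nil {t : ℕ → M.Γ} {n : ℕ} (h0 : t 0 = M.leftEnd) (hn : 0 < n) :
    M.stackOf t n ≠ [] := by
  induction n with
  | zero => omega
  | succ n ih =>
    rw [stackOf]
    split
    · rename_i hf
      rcases Nat.eq_zero_or_pos n with rfl | hn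
      · exact absurd (h0.symm.trans hf) M.leftEnd_ne_frozen
      · exact ih hn
    · simp

variable (M) in
/-- The configuration `c` of `M` on input `x` is represented by a configuration of the simulating
pushdown machine. -/
structure Represents (x : List α) (p : M.Q × Place) (σ : InputSymbol α) (r : List α)
    (s : List (M.Γ × Bool)) (c : M.Cfg) : Prop where
  state : c.state = p.1
  symbol : σ = inputCell x c.inputPos
  rest : r = x.drop c.inputPos
  place : ∃ n, M.IsFrontier c.tape n ∧ M.Located c.tape n c.storagePos p.2 s

theorem Represents.step (hM : M.DepthSusceptible) {x : List α} {p : M.Q × Place}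
    {σ : InputSymbol α} {r : List α} {s : List (M.Γ × Bool)} {c : M.Cfg}
    (h : M.Represents x p σ r s c) (hacc : c.state ∉ M.acc) (hrej : c.state ∉ M.rej) :
    M.Represents x p σ r s (M.step x c) ∨ ∃ X s', s = X :: s' ∧
      M.Represents x (M.pdaMove p σ X).1 (EndmarkedPDA.nextSymbol (M.pdaMove p σ X).2.1 σ r)
        (EndmarkedPDA.nextRest (M.pdaMove p σ X).2.1 r) ((M.pdaMove p σ X).2.2 ++ s')
        (M.step x c) := by
  classical
  rw [step_of_not_halted hacc hrej]
  obtain ⟨q, i, h, t⟩ := c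
  obtain ⟨q', pl⟩ := p
  obtain ⟨hq, rfl, rfl, n, ht, hloc⟩ := h
  obtain rfl : q = q' := hq
  clear hacc hrej
  dsimp only at *
  cases pl with
  | front b =>
    obtain ⟨rfl, rfl, hb⟩ := hloc
    have hth : t h = M.blank := ht.right h le_rfl
    obtain ⟨h, rfl⟩ := Nat.exists_eq_add_of_lt ht.pos
    rw [Nat.zero_add] at *
    rw [Nat.add_sub_cancel] at hb
    rw [hth]
    obtain ⟨X, s, hX⟩ := List.exists_cons_of_ne_nil (stackOf_ne_nil ht.zero ht.pos)
    refine .inr ⟨X, s, hX, ?_⟩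
    rcases hd : (M.δ q (inputCell x i) M.blank).storageDir with _ | _ | _
    · simp only [pdaMove, hd]
      refine ⟨rfl, (inputCell_add ..).symm, (drop_add ..).symm, h + 1, ?_⟩
      rw [M.stationary _ _ _ hd, Function.update_eq_self_iff.2 hth.symm]
      exact ⟨ht, by simp [SignType.zero_eq_zero], hX.symm, hb⟩
    · simp only [pdaMove, hd]
      refine ⟨rfl, (inputCell_add ..).symm, (drop_add ..).symm, h + 1 + 1, ?_⟩
      rw [write_blank_neg hd]
      refine ⟨ht.update_frontier M.leftEnd_ne_frozen.symm frozen_ne_blank, ?_⟩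
      have hpos : (((h + 1 : ℕ) : ℤ) + ((SignType.neg : SignType) : ℤ)).toNat = h := by
        simp [SignType.neg_eq_neg_one]
      have hloc := located_leftwards (t := Function.update t (h + 1) M.frozen) (n := h + 1 + 1)
        (h := h) (by omega) (fun j hj hj' => by
          obtain rfl : j = h + 1 := by omega
          rw [Function.update_self])
      rw [M.stackOf_congr (t' := t) (fun j hj => Function.update_of_ne (by omega) ..), hX,
        Function.update_of_ne (by omega)] at hloc
      have hbd : decide (t h = M.frozen) = b := by
        rw [Bool.eq_iff_iff, hb, decide_eq_true_iff]
      rw [hbd] at hloc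
      dsimp only
      rw [hpos]
      exact hloc
    · simp only [pdaMove, hd]
      obtain ⟨hw1, hw2, hw3⟩ := write_blank_pos hd
      refine ⟨rfl, (inputCell_add ..).symm, (drop_add ..).symm, h + 1 + 1,
        ht.update_frontier hw1 hw2, by simp [SignType.pos_eq_one]; rfl, ?_, ?_⟩ <;> dsimp only
      · rw [stackOf, Function.update_self, if_neg hw3, Nat.add_sub_cancel,
          Function.update_of_ne (by omega),
          M.stackOf_congr (t' := t) (fun j hj => Function.update_of_ne (by omega) ..), hX]
        have hbd : decide (t h = M.frozen) = b := by
          rw [Bool.eq_iff_iff, hb, decide_eq_true_iff]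
        simp [hbd]
      · rw [Nat.add_sub_cancel, Function.update_self]
        simpa using hw3
  | gap =>
    obtain ⟨hn, hB, rfl⟩ := hloc
    have hth : t h = M.frozen := hB h le_rfl hn
    have h0 : h ≠ 0 := by
      rintro rfl
      exact M.leftEnd_ne_frozen (ht.zero.symm.trans hth)
    obtain ⟨X, s, hX⟩ := List.exists_cons_of_ne_nil (stackOf_ne_nil ht.zero (Nat.pos_of_ne_zero h0))
    have hX' : M.stackOf t (h + 1) = X :: s := by rw [stackOf, if_pos hth, hX]
    rw [hth, hX, hM.2, hM.1 _ _ _ (.inr M.frozen_level), M.top_unmodified _ _ _ M.frozen_level,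
      Function.update_eq_self_iff.2 hth.symm]
    rcases hd : (M.δ q (inputCell x i) M.frozen).storageDir with _ | _ | _
    · exact .inl ⟨rfl, rfl, rfl, n, ht, by simpa [SignType.zero_eq_zero] using hn,
        by simpa [SignType.zero_eq_zero] using hB, by simpa [SignType.zero_eq_zero] using hX.symm⟩
    · obtain ⟨h, rfl⟩ := Nat.exists_eq_succ_of_ne_zero h0
      have hpos : (((h + 1 : ℕ) : ℤ) + ((SignType.neg : SignType) : ℤ)).toNat = h := by
        simp [SignType.neg_eq_neg_one]
      have hloc := located_leftwards (t := t) (n := n) (h := h) hn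
        (fun j hj hj' => hB j (by omega) hj')
      rw [Nat.succ_eq_add_one] at *
      rw [hX] at hloc
      by_cases hf : t h = M.frozen
      · refine .inl ⟨rfl, rfl, rfl, n, ht, ?_⟩
        dsimp only
        rw [hpos]
        simpa [hf, Place.leftwards] using hloc
      · refine .inr ⟨X, s, rfl, ?_⟩
        simp only [pdaMove, hd]
        refine ⟨rfl, rfl, rfl, n, ht, ?_⟩
        dsimp only
        rw [hpos]
        simpa [hf, Place.leftwards] using hloc
    · have hpos : ((h : ℤ) + ((SignType.pos : SignType) : ℤ)).toNat = h + 1 := by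
        simp [SignType.pos_eq_one]
      rcases (Nat.succ_le_of_lt hn).lt_or_eq with hn' | rfl
      · refine .inl ⟨rfl, rfl, rfl, n, ht, ?_⟩
        dsimp only
        rw [hpos]
        exact ⟨hn', fun j hj hj' => hB j (by omega) hj', hX'.symm⟩
      · refine .inr ⟨X, s, rfl, ?_⟩
        simp only [pdaMove, hd]
        refine ⟨rfl, rfl, rfl, h + 1, ht, ?_⟩
        dsimp only
        rw [hpos]
        exact ⟨rfl, hX'.symm, by simpa using hth⟩
  | top b =>
    obtain ⟨hn, hf, hB, rfl, hb, hb0⟩ := hloc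
    have hX : M.stackOf t (h + 1) = (t h, decide (t (h - 1) = M.frozen)) :: M.stackOf t h := by
      rw [stackOf, if_neg hf]
    refine .inr ⟨_, _, hX, ?_⟩
    have hlev : t h ≠ M.leftEnd → 0 < h ∧ h + 1 < n ∧ M.dv (t h) = 1 := by
      intro hl
      have h0 : h ≠ 0 := by rintro rfl; exact hl ht.zero
      exact ⟨by omega, hb.1 (hb0 h0), level_one (ht.left h (by omega) hn).2 hl hf⟩
    rcases hd : (M.δ q (inputCell x i) (t h)).storageDir with _ | _ | _
    · simp only [pdaMove, hd]
      refine ⟨rfl, (inputCell_add ..).symm, (drop_add ..).symm, n, ?_⟩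
      dsimp only
      rw [M.stationary _ _ _ hd, Function.update_eq_self]
      refine ⟨ht, ?_⟩
      have hpos : ((h : ℤ) + ((SignType.zero : SignType) : ℤ)).toNat = h := by
        simp [SignType.zero_eq_zero]
      rw [hpos]
      exact ⟨hn, hf, hB, hX.symm, hb, hb0⟩
    · simp only [pdaMove, hd]
      have hl : t h ≠ M.leftEnd := fun hl => M.storage_bounded q (inputCell x i) (hl ▸ hd)
      obtain ⟨h0, hn', h1⟩ := hlev hl
      refine ⟨rfl, (inputCell_add ..).symm, (drop_add ..).symm, n, ?_⟩
      dsimp only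
      rw [write_level_one h1 (by rw [hd]; simp)]
      refine ⟨ht.update_inner h0 hn M.leftEnd_ne_frozen.symm frozen_ne_blank, ?_⟩
      obtain ⟨h, rfl⟩ := Nat.exists_eq_succ_of_ne_zero h0.ne'
      rw [Nat.succ_eq_add_one] at *
      have hpos : (((h + 1 : ℕ) : ℤ) + ((SignType.neg : SignType) : ℤ)).toNat = h := by
        simp [SignType.neg_eq_neg_one]
      have hloc := located_leftwards (t := Function.update t (h + 1) M.frozen) (n := n)
        (h := h) (by omega) (fun j hj hj' => by
          rcases eq_or_ne j (h + 1) with rfl | hne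
          · rw [Function.update_self]
          · rw [Function.update_of_ne hne]
            exact hB j (by omega) hj')
      rw [M.stackOf_congr (t' := t) (fun j hj => Function.update_of_ne (by omega) ..),
        Function.update_of_ne (by omega)] at hloc
      rw [hpos]
      exact hloc
    · have hpos : ((h : ℤ) + ((SignType.pos : SignType) : ℤ)).toNat = h + 1 := by
        simp [SignType.pos_eq_one]
      by_cases hl : t h = M.leftEnd
      · have h0 : h = 0 := by
          by_contra h0
          exact (ht.left h (by omega) hn).1 hl
        subst h0
        simp only [pdaMove, hd]
        rw [if_pos hl]
        refine ⟨rfl, (inputCell_add ..).symm, (drop_add ..).symm, n, ?_⟩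
        dsimp only
        rw [M.top_unmodified _ _ _ (hl ▸ M.leftEnd_level), Function.update_eq_self, hpos]
        refine ⟨ht, ?_⟩
        cases b with
        | true =>
          exact ⟨hb.1 rfl, fun j hj hj' => hB j (by omega) hj', hX.symm⟩
        | false =>
          have : n = 1 := by
            have := mt hb.2 (by simp)
            omega
          subst this
          exact ⟨rfl, hX.symm, by simpa using hf⟩
      · obtain ⟨h0, hn', h1⟩ := hlev hl
        simp only [pdaMove, hd]
        rw [if_neg hl]
        refine ⟨rfl, (inputCell_add ..).symm, (drop_add ..).symm, n, ?_⟩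
        dsimp only
        rw [write_level_one h1 (by rw [hd]; simp), hpos]
        refine ⟨ht.update_inner h0 hn M.leftEnd_ne_frozen.symm frozen_ne_blank, hn', ?_, ?_⟩
        · intro j hj hj'
          rw [Function.update_of_ne (by omega)]
          exact hB j (by omega) hj'
        · rw [stackOf, if_pos (Function.update_self ..),
            M.stackOf_congr (t := Function.update t h M.frozen) (t' := t)
              (fun j hj => Function.update_of_ne (by omega) ..)]
          rfl

theorem Represents.ne_nil {x : List α} {p : M.Q × Place} {σ : InputSymbol α} {r : List α}
    {s : List (M.Γ × Bool)} {c : M.Cfg} (h : M.Represents x p σ r s c) : s ≠ [] := by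
  obtain ⟨q, i, h, t⟩ := c
  obtain ⟨q', pl⟩ := p
  obtain ⟨-, -, -, n, ht, hloc⟩ := h
  cases pl with
  | front b =>
    obtain ⟨-, rfl, -⟩ := hloc
    exact stackOf_ne_nil ht.zero ht.pos
  | gap =>
    obtain ⟨hn, hB, rfl⟩ := hloc
    refine stackOf_ne_nil ht.zero (Nat.pos_of_ne_zero ?_)
    rintro rfl
    exact M.leftEnd_ne_frozen (ht.zero.symm.trans (hB 0 le_rfl hn))
  | top b =>
    obtain ⟨-, -, -, rfl, -⟩ := hloc
    exact stackOf_ne_nil ht.zero (Nat.succ_pos _)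

/-- If `M` halts, then the simulating machine gives the same verdict. -/
theorem Represents.eval (hM : M.DepthSusceptible) {x : List α} {b : Bool} {n : ℕ}
    {p : M.Q × Place} {σ : InputSymbol α} {r : List α} {s : List (M.Γ × Bool)} {c : M.Cfg}
    (h : M.Represents x p σ r s c)
    (hn : ((M.step x)^[n] c).state ∈ if b then M.acc else M.rej) :
    M.toEndmarkedPDA.Eval p σ r s b := by
  induction n generalizing p σ r s c with
  | zero =>
    rw [Function.iterate_zero, id, h.state] at hn
    cases b with
    | true => exact .acc hn h.ne_nil
    | false => exact .rej hn
  | succ n ih =>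
    by_cases hh : c.state ∈ M.acc ∪ M.rej
    · have hfix : M.step x c = c := if_pos hh
      rw [Function.iterate_succ_apply, hfix] at hn
      exact ih h hn
    · rw [Set.mem_union, not_or] at hh
      rw [Function.iterate_succ_apply] at hn
      rcases h.step hM hh.1 hh.2 with h' | ⟨X, s, rfl, h'⟩
      · exact ih h' hn
      · rw [h.state] at hh
        exact .step hh.1 hh.2 (ih h' hn)

theorem represents_init (x : List α) :
    M.Represents x (M.start, .top false) .leftEnd x [(M.leftEnd, false)] M.init where
  state := rfl
  symbol := rfl
  rest := rfl
  place := by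
    have h0 : M.init.tape 0 = M.leftEnd := by simp [init]
    have hne : ∀ i, 1 ≤ i → M.init.tape i = M.blank := fun i hi => by
      simp [init, Function.update_of_ne (Nat.one_le_iff_ne_zero.1 hi)]
    refine ⟨1, ⟨one_pos, h0, fun i hi hi' => by omega, hne⟩, one_pos, h0.trans_ne
      M.leftEnd_ne_frozen, fun i hi hi' => by omega, ?_, by simp [init], fun h => absurd rfl h⟩
    simp [init, stackOf, M.leftEnd_ne_frozen]

theorem mem_DCFL_of_recognizes [Finite α] {L : Language α} (hM : M.DepthSusceptible)
    (hL : M.Recognizes L) : L ∈ DCFL α := by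
  refine ⟨M.toEndmarkedPDA.toDPDA, fun x => ?_⟩
  by_cases hx : x ∈ L
  · obtain ⟨n, hn⟩ := hL.1 x hx
    have := M.toEndmarkedPDA.toDPDA_accepts_iff ((represents_init x).eval hM (b := true) hn)
    simp [hx, this]
  · obtain ⟨n, hn⟩ := hL.2 x hx
    have := M.toEndmarkedPDA.toDPDA_accepts_iff ((represents_init x).eval hM (b := false) hn)
    simp [hx, this]

end DepthTwo
end StorageAutomaton

/-! ### The storage automaton of a pushdown automaton -/

namespace StorageAutomaton

section Run

variable {k : ℕ} {α : Type} {M : StorageAutomaton k α}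

/-- Started in the configuration `c`, the automaton `M` decides the proposition `p`. -/
def Decides (M : StorageAutomaton k α) (x : List α) (c : M.Cfg) (p : Prop) : Prop :=
  (p → ∃ n, ((M.step x)^[n] c).state ∈ M.acc) ∧ (¬ p → ∃ n, ((M.step x)^[n] c).state ∈ M.rej)

theorem Decides.of_step {x : List α} {q q' : M.Q} {i h : ℕ} {t : ℕ → M.Γ} {w : M.Γ} {d : Fin 2}
    {e : SignType} {p : Prop} (hδ : M.δ q (inputCell x i) (t h) = ⟨q', w, d, e⟩)
    (H : M.Decides x ⟨q', i + d.val, ((h : ℤ) + (e : ℤ)).toNat, Function.update t h w⟩ p)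
    (hacc : q ∉ M.acc) (hrej : q ∉ M.rej) : M.Decides x ⟨q, i, h, t⟩ p := by
  have hs := step_of_not_halted (x := x) (c := ⟨q, i, h, t⟩) hacc hrej
  dsimp only at hs
  rw [hδ] at hs
  rw [← hs] at H
  exact ⟨fun hp => (H.1 hp).imp' Nat.succ fun n hn => by rwa [Function.iterate_succ_apply],
    fun hp => (H.2 hp).imp' Nat.succ fun n hn => by rwa [Function.iterate_succ_apply]⟩

theorem Decides.of_acc {x : List α} {c : M.Cfg} {p : Prop} (hc : c.state ∈ M.acc) (hp : p) :
    M.Decides x c p :=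
  ⟨fun _ => ⟨0, hc⟩, fun h => absurd hp h⟩

theorem Decides.of_rej {x : List α} {c : M.Cfg} {p : Prop} (hc : c.state ∈ M.rej) (hp : ¬ p) :
    M.Decides x c p :=
  ⟨fun h => absurd h hp, fun _ => ⟨0, hc⟩⟩

end Run

end StorageAutomaton

namespace DPDA

variable {α : Type} (D : DPDA α)

theorem exists_length_bound [Finite α] : ∃ N, 1 ≤ N ∧ ∀ p X a q w, D.Reads p X a q w →
    w.length ≤ N := by
  classical
  have := D.finite_Q
  have := D.finite_Γ
  let f : D.Q × D.Γ × α → ℕ := fun y =>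
    if h : ∃ w q, D.Reads y.1 y.2.1 y.2.2 q w then h.choose.length else 0
  obtain ⟨N, hN⟩ := (Set.finite_range f).bddAbove
  refine ⟨N + 1, by omega, fun p X a q w h => ?_⟩
  have hf := hN ⟨(p, X, a), rfl⟩
  have hex : ∃ w q, D.Reads p X a q w := ⟨w, q, h⟩
  have hval : f (p, X, a) = hex.choose.length := dif_pos hex
  obtain ⟨q', h'⟩ := hex.choose_spec
  rw [hval, ← (h.unique h').2] at hf
  omega

/-- States of the storage automaton that simulates `D`. In `push p l` the stack is on the storage
tape and the symbols of `l` still have to be pushed, in this order; when `l` is empty, the top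
symbol is fetched. In `fetched p X` the symbol `X` has been popped and the storage head returns to
the frontier. -/
inductive StorageState (N : ℕ) where
  | start : StorageState N
  | push : D.Q → {l : List D.Γ // l.length ≤ N} → StorageState N
  | fetched : D.Q → D.Γ → StorageState N
  | acc : StorageState N
  | rej : StorageState N

/-- Storage symbols of the storage automaton that simulates `D`. -/
inductive StorageSymbol where
  | blank : StorageSymbol
  | left : StorageSymbol
  | frozen : StorageSymbol
  | stack : D.Γ → StorageSymbol

instance (N : ℕ) : Finite (D.StorageState N) := by
  have := D.finite_Q
  have := D.finite_Γ
  have : Finite {l : List D.Γ // l.length ≤ N} := List.finite_length_le D.Γ N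
  refine Finite.of_surjective
    (fun o : Fin 3 ⊕ (D.Q × {l : List D.Γ // l.length ≤ N}) ⊕ (D.Q × D.Γ) => match o with
      | .inl 0 => .start
      | .inl 1 => .acc
      | .inl 2 => .rej
      | .inr (.inl y) => .push y.1 y.2
      | .inr (.inr y) => .fetched y.1 y.2) ?_
  rintro (_ | ⟨p, l⟩ | ⟨p, X⟩ | _ | _)
  · exact ⟨.inl 0, rfl⟩
  · exact ⟨.inr (.inl (p, l)), rfl⟩
  · exact ⟨.inr (.inr (p, X)), rfl⟩
  · exact ⟨.inl 1, rfl⟩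
  · exact ⟨.inl 2, rfl⟩

instance : Finite D.StorageSymbol := by
  have := D.finite_Γ
  refine Finite.of_surjective
    (fun o : Fin 3 ⊕ D.Γ => match o with
      | .inl 0 => .blank
      | .inl 1 => .left
      | .inl 2 => .frozen
      | .inr X => .stack X) ?_
  rintro (_ | _ | _ | X)
  · exact ⟨.inl 0, rfl⟩
  · exact ⟨.inl 1, rfl⟩
  · exact ⟨.inl 2, rfl⟩
  · exact ⟨.inr X, rfl⟩

variable {D} {N : ℕ}

open Classical in
/-- The state in which the simulation continues once it is known that `X` will be popped without
input being consumed, or the rejecting state if `X` is never popped. -/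
noncomputable def popMove (p : D.Q) (X : D.Γ) : D.StorageState N :=
  if h : ∃ q, D.Pops p X q then .push h.choose ⟨[], Nat.zero_le _⟩ else .rej

theorem popMove_of_pops {p q : D.Q} {X : D.Γ} (h : D.Pops p X q) :
    popMove p X = (.push q ⟨[], Nat.zero_le N⟩ : D.StorageState N) := by
  have hex : ∃ q, D.Pops p X q := ⟨q, h⟩
  rw [popMove, dif_pos hex, h.unique hex.choose_spec]

theorem popMove_of_not_pops {p : D.Q} {X : D.Γ} (h : ∀ q, ¬ D.Pops p X q) :
    popMove p X = (.rej : D.StorageState N) :=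
  dif_neg (not_exists.2 h)

open Classical in
/-- The move at the frontier on the symbol `σ` once the top symbol `X` is known. -/
noncomputable def fetchedMove (hN : ∀ p X a q w, D.Reads p X a q w → w.length ≤ N)
    (σ : InputSymbol α) (p : D.Q) (X : D.Γ) : StorageMove (D.StorageState N) D.StorageSymbol :=
  match σ with
  | .leftEnd => ⟨.rej, .blank, 0, 0⟩
  | .letter a =>
    if h : ∃ y : D.Q × List D.Γ, D.Reads p X a y.1 y.2 then
      ⟨.push h.choose.1 ⟨h.choose.2.reverse, by
        rw [List.length_reverse]; exact hN _ _ _ _ _ h.choose_spec⟩, .blank, 1, 0⟩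
    else ⟨popMove p X, .blank, 0, 0⟩
  | .rightEnd =>
    if D.VisitsFinal p X then ⟨.acc, .blank, 0, 0⟩ else ⟨popMove p X, .blank, 0, 0⟩

theorem fetchedMove_of_reads {hN : ∀ p X a q w, D.Reads p X a q w → w.length ≤ N}
    {p q : D.Q} {X : D.Γ} {a : α} {w : List D.Γ} (h : D.Reads p X a q w) :
    fetchedMove hN (.letter a) p X =
      ⟨.push q ⟨w.reverse, by rw [List.length_reverse]; exact hN _ _ _ _ _ h⟩, .blank, 1, 0⟩ := by
  have hex : ∃ y : D.Q × List D.Γ, D.Reads p X a y.1 y.2 := ⟨(q, w), h⟩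
  obtain ⟨h1, h2⟩ := h.unique hex.choose_spec
  subst h1
  subst h2
  exact dif_pos hex

theorem fetchedMove_of_not_reads {hN : ∀ p X a q w, D.Reads p X a q w → w.length ≤ N}
    {p : D.Q} {X : D.Γ} {a : α} (h : ∀ q w, ¬ D.Reads p X a q w) :
    fetchedMove hN (.letter a) p X = ⟨popMove p X, .blank, 0, 0⟩ :=
  dif_neg fun ⟨_, hy⟩ => h _ _ hy

open Classical in
/-- The transition function of the storage automaton that simulates `D`. -/
noncomputable def storageStep (hN₁ : 1 ≤ N) (hN : ∀ p X a q w, D.Reads p X a q w → w.length ≤ N) :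
    D.StorageState N → InputSymbol α → D.StorageSymbol →
      StorageMove (D.StorageState N) D.StorageSymbol
  | .push p l, _, .frozen => ⟨.push p l, .frozen, 0, -1⟩
  | .fetched p X, _, .frozen => ⟨.fetched p X, .frozen, 0, 1⟩
  | q, _, .frozen => ⟨q, .frozen, 0, 0⟩
  | .start, _, .left => ⟨.push D.start ⟨[D.bottom], hN₁⟩, .left, 0, 1⟩
  | .push p _, σ, .left => ⟨if p ∈ D.final ∧ σ = .rightEnd then .acc else .rej, .left, 0, 0⟩
  | _, _, .left => ⟨.rej, .left, 0, 0⟩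
  | .push p _, _, .stack X => ⟨.fetched p X, .frozen, 0, 1⟩
  | _, _, .stack X => ⟨.rej, .stack X, 0, 0⟩
  | q, .leftEnd, .blank => ⟨q, .blank, 1, 0⟩
  | .push p ⟨[], h⟩, _, .blank => ⟨.push p ⟨[], h⟩, .frozen, 0, -1⟩
  | .push p ⟨Z :: l, h⟩, _, .blank =>
    ⟨.push p ⟨l, (Nat.le_succ _).trans h⟩, .stack Z, 0, 1⟩
  | .fetched p X, σ, .blank => fetchedMove hN σ p X
  | _, _, .blank => ⟨.rej, .blank, 0, 0⟩

theorem fetchedMove_write (hN : ∀ p X a q w, D.Reads p X a q w → w.length ≤ N)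
    (σ : InputSymbol α) (p : D.Q) (X : D.Γ) :
    (fetchedMove hN σ p X).write = .blank ∧ (fetchedMove hN σ p X).storageDir = 0 ∧
      (σ = .rightEnd → (fetchedMove hN σ p X).inputDir = 0) := by
  unfold fetchedMove
  split
  · exact ⟨rfl, rfl, fun _ => rfl⟩
  · split
    · exact ⟨rfl, rfl, fun h => by cases h⟩
    · exact ⟨rfl, rfl, fun _ => rfl⟩
  · split <;> exact ⟨rfl, rfl, fun _ => rfl⟩

theorem storageStep_inputDir {hN₁ : 1 ≤ N}
    {hN : ∀ p X a q w, D.Reads p X a q w → w.length ≤ N} (q : D.StorageState N)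
    (σ : InputSymbol α) (γ : D.StorageSymbol) (h : σ = .rightEnd ∨ γ ≠ .blank) :
    (storageStep hN₁ hN q σ γ).inputDir = 0 := by
  rcases γ with _ | _ | _ | X
  · obtain rfl := h.resolve_right (· rfl)
    rcases q with _ | ⟨p, ⟨_ | ⟨Z, l⟩, h⟩⟩ | ⟨p, X⟩ | _ | _ <;>
      first | rfl | exact (fetchedMove_write hN _ _ _).2.2 rfl
  all_goals cases q <;> rfl

/-- The combinations of scanned symbol, direction and written symbol that occur. -/
theorem storageStep_shape {hN₁ : 1 ≤ N} {hN : ∀ p X a q w, D.Reads p X a q w → w.length ≤ N}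
    (q : D.StorageState N) (σ : InputSymbol α) (γ : D.StorageSymbol) :
    ((storageStep hN₁ hN q σ γ).storageDir = 0 ∧ (storageStep hN₁ hN q σ γ).write = γ) ∨
    (γ = .blank ∧ (storageStep hN₁ hN q σ γ).storageDir = 1 ∧
      ∃ Z, (storageStep hN₁ hN q σ γ).write = .stack Z) ∨
    (γ = .blank ∧ (storageStep hN₁ hN q σ γ).storageDir = -1 ∧
      (storageStep hN₁ hN q σ γ).write = .frozen) ∨
    (∃ X, γ = .stack X ∧ (storageStep hN₁ hN q σ γ).storageDir = 1 ∧
      (storageStep hN₁ hN q σ γ).write = .frozen) ∨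
    (γ = .frozen ∧ (storageStep hN₁ hN q σ γ).write = .frozen) ∨
    (γ = .left ∧ (storageStep hN₁ hN q σ γ).storageDir = 1 ∧
      (storageStep hN₁ hN q σ γ).write = .left) := by
  rcases γ with _ | _ | _ | X
  · rcases q with _ | ⟨p, ⟨_ | ⟨Z, l⟩, h⟩⟩ | ⟨p, X⟩ | _ | _ <;> rcases σ with _ | a | _ <;>
      first
        | exact .inl ⟨rfl, rfl⟩
        | exact .inr (.inl ⟨rfl, rfl, _, rfl⟩)
        | exact .inr (.inr (.inl ⟨rfl, rfl, rfl⟩))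
        | exact .inl ⟨(fetchedMove_write hN _ _ _).2.1, (fetchedMove_write hN _ _ _).1⟩
  · cases q <;>
      first
        | exact .inl ⟨rfl, rfl⟩
        | exact .inr (.inr (.inr (.inr (.inr ⟨rfl, rfl, rfl⟩))))
  · cases q <;> exact .inr (.inr (.inr (.inr (.inl ⟨rfl, rfl⟩))))
  · cases q <;>
      first
        | exact .inl ⟨rfl, rfl⟩
        | exact .inr (.inr (.inr (.inl ⟨X, rfl, rfl, rfl⟩)))

/-- The level of a storage symbol. -/
def storageLevel : D.StorageSymbol → ℕ
  | .blank => 0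
  | .stack _ => 1
  | _ => 2

/-- The storage automaton that simulates `D`: the stack is the sequence of `stack` symbols on the
storage tape, and popping turns a symbol into the frozen blank. -/
noncomputable def toStorage (hN₁ : 1 ≤ N)
    (hN : ∀ p X a q w, D.Reads p X a q w → w.length ≤ N) : StorageAutomaton 2 α where
  Q := D.StorageState N
  Γ := D.StorageSymbol
  finite_Q := inferInstance
  finite_Γ := inferInstance
  dv := storageLevel
  blank := .blank
  leftEnd := .left
  frozen := .frozen
  dv_le γ := by cases γ <;> simp [storageLevel]
  dv_eq_zero γ := by cases γ <;> simp [storageLevel]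
  dv_eq_top γ := by cases γ <;> simp [storageLevel]
  leftEnd_ne_frozen := by simp
  δ := storageStep hN₁ hN
  start := .start
  acc := {.acc}
  rej := {.rej}
  acc_rej_disjoint := by simp
  input_bounded q γ := storageStep_inputDir q _ γ (.inl rfl)
  storage_bounded q σ := by
    rcases q with _ | ⟨p, l⟩ | ⟨p, X⟩ | _ | _ <;> simp [storageStep]
  top_unmodified q σ γ hγ := by
    rcases storageStep_shape (hN₁ := hN₁) (hN := hN) q σ γ with h | ⟨rfl, -⟩ | ⟨rfl, -⟩ |
      ⟨X, rfl, -⟩ | ⟨rfl, h⟩ | ⟨rfl, -, h⟩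
    · exact h.2
    · simp [storageLevel] at hγ
    · simp [storageLevel] at hγ
    · simp [storageLevel] at hγ
    · exact h
    · exact h
  leftEnd_not_written q σ γ hγ := by
    rcases storageStep_shape (hN₁ := hN₁) (hN := hN) q σ γ with h | ⟨rfl, -, Z, h⟩ | ⟨rfl, -, h⟩ |
      ⟨X, rfl, -, h⟩ | ⟨rfl, h⟩ | ⟨rfl, -, h⟩
    · exact h.2.trans_ne hγ
    · simp [h]
    · simp [h]
    · simp [h]
    · simp [h]
    · exact absurd rfl hγ
  stationary q σ γ hγ := by
    rcases storageStep_shape (hN₁ := hN₁) (hN := hN) q σ γ with h | ⟨rfl, h, -⟩ | ⟨rfl, h, -⟩ |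
      ⟨X, rfl, h, -⟩ | ⟨rfl, h⟩ | ⟨rfl, -, h⟩
    · exact h.2
    · simp [h] at hγ
    · simp [h] at hγ
    · simp [h] at hγ
    · exact h
    · exact h
  depth_pass q σ γ hγ hd := by
    rcases storageStep_shape (hN₁ := hN₁) (hN := hN) q σ γ with h | ⟨rfl, -, Z, h⟩ | ⟨rfl, h, -⟩ |
      ⟨X, rfl, -, h⟩ | ⟨rfl, h⟩ | ⟨rfl, -, h⟩
    · rw [h.1] at hd
      exact absurd hd.symm (pow_ne_zero _ (by simp))
    · simp [h, storageLevel]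
    · simp [h, storageLevel] at hd
    · simp [h, storageLevel]
    · simp [storageLevel] at hγ
    · simp [storageLevel] at hγ
  depth_turn q σ γ hγ hd := by
    rcases storageStep_shape (hN₁ := hN₁) (hN := hN) q σ γ with h | ⟨rfl, h, -⟩ | ⟨rfl, -, h⟩ |
      ⟨X, rfl, -, h⟩ | ⟨rfl, h⟩ | ⟨rfl, -, h⟩
    · rw [h.1] at hd
      exact absurd hd.symm (pow_ne_zero _ (by simp))
    · simp [h, storageLevel] at hd
    · simp [h, storageLevel]
    · simp [h, storageLevel]
    · simp [storageLevel] at hγ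
    · simp [storageLevel] at hγ

theorem toStorage_depthSusceptible (hN₁ : 1 ≤ N)
    (hN : ∀ p X a q w, D.Reads p X a q w → w.length ≤ N) :
    (toStorage hN₁ hN).DepthSusceptible := by
  constructor
  · intro q σ γ h
    refine storageStep_inputDir q σ γ (.inr ?_)
    rintro rfl
    simp [toStorage, storageLevel] at h
  · intro q σ
    rcases q with _ | ⟨p, l⟩ | ⟨p, X⟩ | _ | _ <;> rfl

end DPDA

/-! ### Correctness of the storage automaton -/

namespace DPDA

open StorageAutomaton

variable {α : Type} {D : DPDA α} {N : ℕ} {hN₁ : 1 ≤ N}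
  {hN : ∀ p X a q w, D.Reads p X a q w → w.length ≤ N}

/-- The stack that the first `h` cells of a storage tape of `D.toStorage` stand for. -/
noncomputable def contents (t : ℕ → D.StorageSymbol) : ℕ → List D.Γ
  | 0 => []
  | h + 1 => match t h with
    | .stack X => X :: contents t h
    | _ => contents t h

theorem contents_congr {t t' : ℕ → D.StorageSymbol} {h : ℕ} (H : ∀ i < h, t i = t' i) :
    contents t h = contents t' h := by
  induction h with
  | zero => rfl
  | succ h ih => rw [contents, contents, H h (by omega), ih fun i hi => H i (by omega)]

theorem contents_succ_frozen {t : ℕ → D.StorageSymbol} {h : ℕ} (ht : t h = .frozen) :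
    contents t (h + 1) = contents t h := by
  rw [contents, ht]

theorem contents_update (t : ℕ → D.StorageSymbol) (h : ℕ) (γ : D.StorageSymbol) :
    contents (Function.update t h γ) h = contents t h :=
  contents_congr fun _ hi => Function.update_of_ne hi.ne ..

/-- Configurations of `toStorage`. -/
def storageCfg (hN₁ : 1 ≤ N) (hN : ∀ p X a q w, D.Reads p X a q w → w.length ≤ N)
    (q : D.StorageState N) (i h : ℕ) (t : ℕ → D.StorageSymbol) : (toStorage hN₁ hN).Cfg :=
  ⟨q, i, h, t⟩

/-- `Continues x q i s P`: the automaton decides `P` on input `x` from every configuration with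
state `q`, input head on cell `i`, storage head on the frontier and stack `s`. -/
def Continues (hN₁ : 1 ≤ N) (hN : ∀ p X a q w, D.Reads p X a q w → w.length ≤ N) (x : List α)
    (q : D.StorageState N) (i : ℕ) (s : List D.Γ) (P : Prop) : Prop :=
  ∀ (n : ℕ) (t : ℕ → D.StorageSymbol), (toStorage hN₁ hN).IsFrontier t n → contents t n = s →
    (toStorage hN₁ hN).Decides x (storageCfg hN₁ hN q i n t) P

theorem decides_of_storageStep {x : List α} {q q' : D.StorageState N} {i h : ℕ}
    {t : ℕ → D.StorageSymbol} {w : D.StorageSymbol} {d : Fin 2} {e : SignType} {P : Prop}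
    (hδ : storageStep hN₁ hN q (inputCell x i) (t h) = ⟨q', w, d, e⟩)
    (H : (toStorage hN₁ hN).Decides x
      (storageCfg hN₁ hN q' (i + d.val) ((h : ℤ) + (e : ℤ)).toNat (Function.update t h w)) P)
    (hacc : q ≠ .acc) (hrej : q ≠ .rej) :
    (toStorage hN₁ hN).Decides x (storageCfg hN₁ hN q i h t) P :=
  Decides.of_step hδ H hacc hrej

theorem decides_acc {x : List α} {i h : ℕ} {t : ℕ → D.StorageSymbol} {P : Prop} (hP : P) :
    (toStorage hN₁ hN).Decides x (storageCfg hN₁ hN .acc i h t) P :=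
  Decides.of_acc rfl hP

theorem decides_rej {x : List α} {i h : ℕ} {t : ℕ → D.StorageSymbol} {P : Prop} (hP : ¬ P) :
    (toStorage hN₁ hN).Decides x (storageCfg hN₁ hN .rej i h t) P :=
  Decides.of_rej rfl hP

theorem toNat_add_one (h : ℕ) : ((h : ℤ) + ((1 : SignType) : ℤ)).toNat = h + 1 := by simp

theorem toNat_sub_one (h : ℕ) : (((h + 1 : ℕ) : ℤ) + ((-1 : SignType) : ℤ)).toNat = h := by simp

theorem toNat_add_zero (h : ℕ) : ((h : ℤ) + ((0 : SignType) : ℤ)).toNat = h := by simp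

/-- The storage head returns through a block of frozen blanks to the frontier. -/
theorem decides_fetched {x : List α} {p : D.Q} {X : D.Γ} {i : ℕ} {s : List D.Γ} {P : Prop}
    (H : Continues hN₁ hN x (.fetched p X) i s P) {n h : ℕ} {t : ℕ → D.StorageSymbol}
    (ht : (toStorage hN₁ hN).IsFrontier t n) (hh : h ≤ n)
    (hB : ∀ j, h ≤ j → j < n → t j = .frozen) (hs : contents t h = s) :
    (toStorage hN₁ hN).Decides x (storageCfg hN₁ hN (.fetched p X) i h t) P := by
  induction hm : n - h generalizing h with
  | zero =>
    obtain rfl : h = n := by omega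
    exact H h t ht hs
  | succ m ih =>
    have hth : t h = .frozen := hB h le_rfl (by omega)
    refine decides_of_storageStep (q' := .fetched p X) (w := .frozen) (d := 0) (e := 1)
      (by rw [hth]; rfl) ?_ (by simp) (by simp)
    rw [toNat_add_one, Function.update_eq_self_iff.2 hth.symm]
    exact ih (by omega) (fun j hj => hB j (by omega)) (by rw [contents_succ_frozen hth]; exact hs) (by omega)

/-- The storage head moves left through a block of frozen blanks; it fetches the top symbol, or finds
the stack empty and halts. -/
theorem decides_fetch {x : List α} {p : D.Q} {hl : [].length ≤ N} {i : ℕ} {s : List D.Γ} {P : Prop}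
    (Hnil : s = [] → (P ↔ p ∈ D.final ∧ inputCell x i = .rightEnd))
    (Hcons : ∀ X s', s = X :: s' → Continues hN₁ hN x (.fetched p X) i s' P)
    {n h : ℕ} {t : ℕ → D.StorageSymbol}
    (ht : (toStorage hN₁ hN).IsFrontier t n) (hh : h < n)
    (hB : ∀ j, h < j → j < n → t j = .frozen) (hs : contents t (h + 1) = s) :
    (toStorage hN₁ hN).Decides x (storageCfg hN₁ hN (.push p ⟨[], hl⟩) i h t) P := by
  induction h with
  | zero =>
    have hth : t 0 = .left := ht.zero
    rw [contents, hth] at hs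
    refine decides_of_storageStep (w := .left) (d := 0) (e := 0) (by rw [hth]; rfl)
      ?_ (by simp) (by simp)
    split
    · next hf => exact decides_acc ((Hnil hs.symm).2 hf)
    · next hf => exact decides_rej (mt (Hnil hs.symm).1 hf)
  | succ h ih =>
    obtain ⟨hl1, hl2⟩ := ht.left (h + 1) (by omega) hh
    rcases hth : t (h + 1) with _ | _ | _ | X
    · exact absurd hth hl2
    · exact absurd hth hl1
    · refine decides_of_storageStep (w := .frozen) (d := 0) (e := -1) (by rw [hth]; rfl)
        ?_ (by simp) (by simp)
      rw [toNat_sub_one, Function.update_eq_self_iff.2 hth.symm]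
      refine ih (by omega) (fun j hj hj' => ?_) ?_
      · rcases eq_or_ne j (h + 1) with rfl | hne
        · exact hth
        · exact hB j (by omega) hj'
      · rw [← hs, contents_succ_frozen hth]
    · rw [contents, hth] at hs
      refine decides_of_storageStep (w := .frozen) (d := 0) (e := 1) (by rw [hth]; rfl)
        ?_ (by simp) (by simp)
      rw [toNat_add_one]
      refine decides_fetched (Hcons X _ hs.symm)
        (ht.update_inner (by omega) hh (W := StorageSymbol.frozen) (by simp [toStorage])
          (by simp [toStorage])) (by omega) ?_ ?_
      · intro j hj hj'
        rw [Function.update_of_ne (by omega)]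
        exact hB j (by omega) hj'
      · rw [contents_succ_frozen (Function.update_self ..), contents_update]

theorem inputCell_succ_eq_rightEnd {x : List α} {j : ℕ} (h : x.drop j = []) :
    inputCell x (j + 1) = .rightEnd := by
  have : x[j]? = none := by simpa using h
  simp [inputCell, this]

theorem inputCell_succ_eq_letter {x r : List α} {a : α} {j : ℕ} (h : x.drop j = a :: r) :
    inputCell x (j + 1) = .letter a := by
  have : x[j]? = some a := by
    have := congrArg List.head? h
    simpa using this
  simp [inputCell, this]

theorem inputCell_succ_ne_leftEnd (x : List α) (j : ℕ) : inputCell x (j + 1) ≠ .leftEnd := by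
  rw [inputCell]
  split <;> simp

/-- Pushing the pending word. -/
theorem Continues.push {x : List α} {p : D.Q} {j : ℕ} {P : Prop} {l : List D.Γ}
    {hl : l.length ≤ N} {s : List D.Γ}
    (H : Continues hN₁ hN x (.push p ⟨[], Nat.zero_le _⟩) (j + 1) (l.reverse ++ s) P) :
    Continues hN₁ hN x (.push p ⟨l, hl⟩) (j + 1) s P := by
  induction l generalizing s with
  | nil => exact H
  | cons Z l ih =>
    intro n t ht hs
    have hn : t n = .blank := ht.right n le_rfl
    have hδ : storageStep hN₁ hN (.push p ⟨Z :: l, hl⟩) (inputCell x (j + 1)) (t n) =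
        ⟨.push p ⟨l, (Nat.le_succ _).trans hl⟩, .stack Z, 0, 1⟩ := by
      rw [hn]
      rcases hσ : inputCell x (j + 1) with _ | a | _
      · exact absurd hσ (inputCell_succ_ne_leftEnd x j)
      · rfl
      · rfl
    refine decides_of_storageStep hδ ?_ (by simp) (by simp)
    rw [toNat_add_one]
    refine ih (s := Z :: s) (by simpa using H) (n + 1) _ (ht.update_frontier (by simp [toStorage])
      (by simp [toStorage])) ?_
    rw [contents, Function.update_self, contents_update, hs]

/-- Popping the top symbol. -/
theorem Continues.fetch {x : List α} {p : D.Q} {j : ℕ} {P : Prop} {s : List D.Γ}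
    (Hnil : s = [] → (P ↔ p ∈ D.final ∧ inputCell x (j + 1) = .rightEnd))
    (Hcons : ∀ X s', s = X :: s' → Continues hN₁ hN x (.fetched p X) (j + 1) s' P) :
    Continues hN₁ hN x (.push p ⟨[], Nat.zero_le _⟩) (j + 1) s P := by
  intro n t ht hs
  obtain ⟨n, rfl⟩ := Nat.exists_eq_succ_of_ne_zero ht.pos.ne'
  rw [Nat.succ_eq_add_one] at *
  have hn : t (n + 1) = .blank := ht.right _ le_rfl
  have hδ : storageStep hN₁ hN (.push p ⟨[], Nat.zero_le _⟩) (inputCell x (j + 1)) (t (n + 1)) =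
      ⟨.push p ⟨[], Nat.zero_le _⟩, .frozen, 0, -1⟩ := by
    rw [hn]
    rcases hσ : inputCell x (j + 1) with _ | a | _
    · exact absurd hσ (inputCell_succ_ne_leftEnd x j)
    · rfl
    · rfl
  refine decides_of_storageStep hδ ?_ (by simp) (by simp)
  rw [toNat_sub_one]
  refine decides_fetch Hnil Hcons (n := n + 1 + 1) (ht.update_frontier (by simp [toStorage])
      (by simp [toStorage])) (by omega) ?_ ?_
  · intro i hi hi'
    obtain rfl : i = n + 1 := by omega
    rw [Function.update_self]
  · rw [contents_update, hs]

/-- A move on a fetched symbol. -/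
theorem Continues.fetched {x : List α} {p : D.Q} {X : D.Γ} {j : ℕ} {P : Prop} {s : List D.Γ}
    {q : D.StorageState N} {d : Fin 2}
    (hδ : fetchedMove hN (inputCell x (j + 1)) p X = ⟨q, .blank, d, 0⟩)
    (H : Continues hN₁ hN x q (j + 1 + d.val) s P) :
    Continues hN₁ hN x (.fetched p X) (j + 1) s P := by
  intro n t ht hs
  have hn : t n = .blank := ht.right n le_rfl
  refine decides_of_storageStep (q' := q) (w := .blank) (d := d) (e := 0) ?_ ?_ (by simp) (by simp)
  · rw [hn, ← hδ]
    rcases hσ : inputCell x (j + 1) with _ | a | _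
    · exact absurd hσ (inputCell_succ_ne_leftEnd x j)
    · rfl
    · rfl
  · rw [toNat_add_zero, Function.update_eq_self_iff.2 hn.symm]
    exact H n t ht hs

/-- After popping without reading, the verdict is that of the automaton on the rest of the stack;
if `X` is never popped, it is negative. -/
theorem continues_popMove {x : List α} {p : D.Q} {X : D.Γ} {i : ℕ} {s : List D.Γ} {P : Prop}
    {R : D.Q → Prop} (hP : P ↔ ∃ q, D.Pops p X q ∧ R q)
    (H : ∀ q, Continues hN₁ hN x (.push q ⟨[], Nat.zero_le _⟩) i s (R q)) :
    Continues hN₁ hN x (popMove p X) i s P := by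
  by_cases h : ∃ q, D.Pops p X q
  · obtain ⟨q, h⟩ := h
    rw [popMove_of_pops h]
    have : P ↔ R q := hP.trans ⟨fun ⟨q', h', hR⟩ => h.unique h' ▸ hR, fun hR => ⟨q, h, hR⟩⟩
    rw [this]
    exact H q
  · rw [popMove_of_not_pops (not_exists.1 h)]
    exact fun n t _ _ => decides_rej (by rw [hP]; exact fun ⟨q, h', _⟩ => h ⟨q, h'⟩)

/-- The storage automaton decides acceptance of the pushdown automaton. -/
theorem continues_acceptsFrom (x r : List α) (s : List D.Γ) (j : ℕ) (hr : x.drop j = r) (p : D.Q) :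
    Continues hN₁ hN x (.push p ⟨[], Nat.zero_le _⟩) (j + 1) s (D.AcceptsFrom ⟨p, r, s⟩) := by
  induction r generalizing j s p with
  | nil =>
    have hσ := inputCell_succ_eq_rightEnd hr
    induction s generalizing p with
    | nil => exact .fetch (fun _ => by simp [acceptsFrom_empty, hσ]) (fun X s' h => by cases h)
    | cons X s ih =>
      refine .fetch (fun h => by cases h) ?_
      rintro _ _ ⟨⟩
      by_cases hv : D.VisitsFinal p X
      · refine .fetched (q := .acc) (d := 0) (by rw [hσ]; exact if_pos hv) fun n t _ _ => ?_
        exact decides_acc (acceptsFrom_nil.2 (.inl hv))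
      · refine .fetched (q := popMove p X) (d := 0) (by rw [hσ]; exact if_neg hv) ?_
        refine continues_popMove (R := fun q => D.AcceptsFrom ⟨q, [], s⟩) ?_ ih
        rw [acceptsFrom_nil, or_iff_right hv]
  | cons a r ihr =>
    have hσ := inputCell_succ_eq_letter hr
    induction s generalizing p with
    | nil => exact .fetch (fun _ => by simp [acceptsFrom_empty, hσ]) (fun X s' h => by cases h)
    | cons X s ih =>
      refine .fetch (fun h => by cases h) ?_
      rintro _ _ ⟨⟩
      by_cases hv : ∃ q w, D.Reads p X a q w
      · obtain ⟨q, w, h⟩ := hv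
        refine .fetched (d := 1) (by rw [hσ]; exact fetchedMove_of_reads h) ?_
        have hP : D.AcceptsFrom ⟨p, a :: r, X :: s⟩ ↔ D.AcceptsFrom ⟨q, r, w ++ s⟩ := by
          rw [acceptsFrom_cons]
          constructor
          · rintro (⟨q', w', h', H⟩ | ⟨q', h', -⟩)
            · obtain ⟨rfl, rfl⟩ := h.unique h'
              exact H
            · exact absurd h' h.not_pops
          · exact fun H => .inl ⟨q, w, h, H⟩
        rw [hP]
        refine .push ?_
        rw [List.reverse_reverse]
        refine ihr (w ++ s) (j + 1) ?_ q
        rw [← List.drop_drop, hr]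
        rfl
      · simp only [not_exists] at hv
        refine .fetched (q := popMove p X) (d := 0)
          (by rw [hσ]; exact fetchedMove_of_not_reads hv) ?_
        refine continues_popMove (R := fun q => D.AcceptsFrom ⟨q, a :: r, s⟩) ?_ ih
        rw [acceptsFrom_cons, or_iff_right]
        rintro ⟨q, w, h, -⟩
        exact hv q w h

theorem decides_init (x : List α) :
    (toStorage hN₁ hN).Decides x (toStorage hN₁ hN).init (D.Accepts x) := by
  have hleft : ∀ t : ℕ → D.StorageSymbol, t = Function.update (fun _ => .blank) 0 .left →
      (toStorage hN₁ hN).Decides x (storageCfg hN₁ hN .start 0 0 t) (D.Accepts x) := by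
    intro t ht
    have h0 : t 0 = .left := by rw [ht, Function.update_self]
    have h1 : t 1 = .blank := by rw [ht]; rfl
    refine decides_of_storageStep (w := .left) (d := 0) (e := 1) (by rw [h0]; rfl)
      ?_ (by simp) (by simp)
    rw [toNat_add_one, Function.update_eq_self_iff.2 h0.symm]
    refine decides_of_storageStep (q' := .push D.start ⟨[D.bottom], hN₁⟩) (w := .blank) (d := 1)
      (e := 0) (by rw [h1]; rfl) ?_ (by simp) (by simp)
    rw [toNat_add_zero, Function.update_eq_self_iff.2 h1.symm]
    have H : Continues hN₁ hN x (.push D.start ⟨[D.bottom], hN₁⟩) (0 + 1) [] (D.Accepts x) :=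
      .push (continues_acceptsFrom x x [D.bottom] 0 rfl D.start)
    refine H 1 t ⟨one_pos, h0, fun i hi hi' => by omega, fun i hi => ?_⟩ ?_
    · rw [ht, Function.update_of_ne (by omega)]
      rfl
    · rw [contents, h0]
      rfl
  exact hleft _ rfl

theorem mem_SDA_of_accepts [Finite α] {L : Language α} (h : ∀ x : List α, x ∈ L ↔ D.Accepts x) :
    L ∈ SDA 2 α := by
  obtain ⟨N, hN₁, hN⟩ := D.exists_length_bound
  refine ⟨toStorage hN₁ hN, toStorage_depthSusceptible hN₁ hN, fun x hx => ?_, fun x hx => ?_⟩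
  · exact (decides_init x).1 ((h x).1 hx)
  · exact (decides_init x).2 (mt (h x).2 hx)

end DPDA

/-! ### Increasing the depth -/

namespace StorageAutomaton

variable {k : ℕ} {α : Type} (M : StorageAutomaton k α)

/-- A move in direction `d` on the symbol `γ`, of level less than `k`, has to write a symbol of level
exactly `k`, in depth `k` as well as in depth `k + 1`. -/
def ReachesTop (γ : M.Γ) (d : SignType) : Prop :=
  ((d : ℤ) = (-1) ^ M.dv γ ∧ M.dv γ + 1 = k) ∨ ((d : ℤ) = (-1) ^ (M.dv γ + 1) ∧ M.dv γ + 2 = k)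

/-- Reads the copy `none` of the frozen blank as the frozen blank. -/
def flatten (g : Option M.Γ) : M.Γ := g.getD M.frozen

open Classical in
/-- The symbol written by the depth-`k + 1` version of `M`. -/
noncomputable def deepWrite (q : M.Q) (σ : InputSymbol α) : Option M.Γ → Option M.Γ
  | none => if (M.δ q σ M.frozen).storageDir = 0 then none else some M.frozen
  | some γ => if M.ReachesTop γ (M.δ q σ γ).storageDir then none else some (M.δ q σ γ).write

open Classical in
/-- Levels in the depth-`k + 1` version of `M`. -/
noncomputable def deepLevel : Option M.Γ → ℕ
  | none => k
  | some γ => if M.dv γ = k then k + 1 else M.dv γ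

variable {M}

theorem write_of_reachesTop {q : M.Q} {σ : InputSymbol α} {γ : M.Γ}
    (h : M.ReachesTop γ (M.δ q σ γ).storageDir) : (M.δ q σ γ).write = M.frozen := by
  refine M.eq_frozen ?_ (M.leftEnd_not_written _ _ _ ?_)
  · rcases h with ⟨h1, h2⟩ | ⟨h1, h2⟩
    · rw [M.depth_pass q σ γ (by omega) h1, h2, min_self]
    · rw [M.depth_turn q σ γ (by omega) h1, h2, min_self]
  · rintro rfl
    rw [ReachesTop, leftEnd_level] at h
    omega

theorem flatten_deepWrite (q : M.Q) (σ : InputSymbol α) (g : Option M.Γ) :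
    M.flatten (M.deepWrite q σ g) = (M.δ q σ (M.flatten g)).write := by
  rcases g with _ | γ
  · have : (M.δ q σ M.frozen).write = M.frozen := M.top_unmodified _ _ _ M.frozen_level
    rw [deepWrite]
    split <;> simp [flatten, this]
  · rw [deepWrite]
    split
    · next h => simp [flatten, write_of_reachesTop h]
    · simp [flatten]

theorem deepLevel_lt {γ : M.Γ} (h : M.deepLevel (some γ) < k + 1) :
    M.dv γ < k ∧ M.deepLevel (some γ) = M.dv γ := by
  rw [deepLevel] at *
  split at h
  · omega
  · next hne => exact ⟨lt_of_le_of_ne (M.dv_le γ) hne, if_neg hne⟩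

theorem neg_one_pow_succ_ne (n : ℕ) : (-1 : ℤ) ^ (n + 1) ≠ (-1) ^ n := by
  have : (-1 : ℤ) ^ n ≠ 0 := pow_ne_zero _ (by simp)
  rw [pow_succ]
  omega

variable (M) in
/-- The depth-`k + 1` version of a depth-`k` automaton. It has one new symbol `none` of level `k`, a
copy of the frozen blank, which is written where depth `k + 1` does not yet allow the frozen blank
itself, and which is replaced by it at the next visit. -/
noncomputable def deepen (hk : 0 < k) : StorageAutomaton (k + 1) α where
  Q := M.Q
  Γ := Option M.Γ
  finite_Q := M.finite_Q
  finite_Γ := by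
    have := M.finite_Γ
    infer_instance
  dv := M.deepLevel
  blank := some M.blank
  leftEnd := some M.leftEnd
  frozen := some M.frozen
  dv_le g := by
    rcases g with _ | γ
    · exact Nat.le_succ k
    · rw [deepLevel]
      split
      · exact le_rfl
      · exact (M.dv_le γ).trans (Nat.le_succ k)
  dv_eq_zero g := by
    rcases g with _ | γ
    · simp [deepLevel, hk.ne']
    · rw [deepLevel, Option.some_inj, ← M.dv_eq_zero]
      split <;> omega
  dv_eq_top g := by
    rcases g with _ | γ
    · simp [deepLevel]
    · rw [deepLevel, Option.some_inj, Option.some_inj, ← M.dv_eq_top]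
      have := M.dv_le γ
      split <;> omega
  leftEnd_ne_frozen := by simpa using M.leftEnd_ne_frozen
  δ q σ g :=
    ⟨(M.δ q σ (M.flatten g)).state, M.deepWrite q σ g, (M.δ q σ (M.flatten g)).inputDir,
      (M.δ q σ (M.flatten g)).storageDir⟩
  start := M.start
  acc := M.acc
  rej := M.rej
  acc_rej_disjoint := M.acc_rej_disjoint
  input_bounded q g := M.input_bounded q _
  storage_bounded q σ := M.storage_bounded q σ
  top_unmodified q σ g hg := by
    rcases g with _ | γ
    · simp [deepLevel] at hg
    · have hγ : M.dv γ = k := by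
        by_contra hne
        rw [deepLevel, if_neg hne] at hg
        have := M.dv_le γ
        omega
      dsimp only
      rw [deepWrite, if_neg, M.top_unmodified _ _ _ hγ]
      rw [ReachesTop]
      omega
  leftEnd_not_written q σ g hg := by
    rcases g with _ | γ
    · dsimp only
      rw [deepWrite]
      split <;> simp [M.leftEnd_ne_frozen.symm]
    · dsimp only
      rw [deepWrite]
      split
      · simp
      · simpa using M.leftEnd_not_written q σ γ (by simpa using hg)
  stationary q σ g hd := by
    rcases g with _ | γ
    · exact if_pos hd
    · have hd : (M.δ q σ γ).storageDir = 0 := hd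
      have : ¬ M.ReachesTop γ (M.δ q σ γ).storageDir := by
        rw [ReachesTop, hd]
        rintro (⟨h, -⟩ | ⟨h, -⟩) <;> exact pow_ne_zero _ (by simp) h.symm
      dsimp only
      rw [deepWrite, if_neg this, M.stationary _ _ _ hd]
  depth_pass q σ g hg hd := by
    dsimp only at *
    rcases g with _ | γ
    · rw [deepWrite, if_neg]
      · simp [deepLevel, frozen_level]
      · intro h
        rw [flatten, Option.getD_none, h] at hd
        exact pow_ne_zero _ (by simp) hd.symm
    · obtain ⟨h1, h2⟩ := deepLevel_lt hg
      rw [h2] at hd ⊢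
      rw [flatten, Option.getD_some] at hd
      have hw := M.depth_pass q σ γ h1 hd
      by_cases ht : M.dv γ + 1 = k
      · rw [deepWrite, if_pos (.inl ⟨hd, ht⟩), deepLevel]
        omega
      · rw [deepWrite, if_neg, deepLevel, if_neg (by omega)]
        · omega
        · rintro (⟨-, h⟩ | ⟨h, -⟩)
          · exact ht h
          · exact neg_one_pow_succ_ne _ (h.symm.trans hd)
  depth_turn q σ g hg hd := by
    dsimp only at *
    rcases g with _ | γ
    · rw [deepWrite, if_neg]
      · simp [deepLevel, frozen_level]
      · intro h
        rw [flatten, Option.getD_none, h] at hd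
        exact pow_ne_zero _ (by simp) hd.symm
    · obtain ⟨h1, h2⟩ := deepLevel_lt hg
      rw [h2] at hd ⊢
      rw [flatten, Option.getD_some] at hd
      have hw := M.depth_turn q σ γ h1 hd
      by_cases ht : M.dv γ + 2 = k
      · rw [deepWrite, if_pos (.inr ⟨hd, ht⟩), deepLevel]
        omega
      · rw [deepWrite, if_neg, deepLevel]
        · split <;> omega
        · rintro (⟨h, -⟩ | ⟨-, h⟩)
          · exact neg_one_pow_succ_ne _ (hd.symm.trans h)
          · exact ht h

theorem deepen_depthSusceptible (hk : 0 < k) (hM : M.DepthSusceptible) :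
    (M.deepen hk).DepthSusceptible := by
  refine ⟨fun q σ g hg => hM.1 q σ _ (.inr ?_), fun q σ => hM.2 q σ⟩
  rcases g with _ | γ
  · exact M.frozen_level
  · by_contra hne
    change M.dv γ ≠ k at hne
    change M.deepLevel (some γ) + 1 = k + 1 ∨ M.deepLevel (some γ) = k + 1 at hg
    rw [deepLevel, if_neg hne] at hg
    have := M.dv_le γ
    omega

/-- The configuration of `M` that corresponds to a configuration of `M.deepen hk`. -/
def flattenCfg (hk : 0 < k) (c : (M.deepen hk).Cfg) : M.Cfg :=
  ⟨c.state, c.inputPos, c.storagePos, fun i => M.flatten (c.tape i)⟩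

theorem flattenCfg_step (hk : 0 < k) (x : List α) (c : (M.deepen hk).Cfg) :
    flattenCfg hk ((M.deepen hk).step x c) = M.step x (flattenCfg hk c) := by
  by_cases hc : c.state ∈ (M.deepen hk).acc ∪ (M.deepen hk).rej
  · have h1 : (M.deepen hk).step x c = c := if_pos hc
    have h2 : M.step x (flattenCfg hk c) = flattenCfg hk c := if_pos hc
    rw [h1, h2]
  · rw [Set.mem_union, not_or] at hc
    rw [step_of_not_halted hc.1 hc.2, step_of_not_halted (M := M) (c := flattenCfg hk c) hc.1 hc.2]
    simp only [flattenCfg]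
    refine congrArg (StorageAutomaton.Cfg.mk _ _ _) (funext fun i => ?_)
    rcases eq_or_ne i c.storagePos with rfl | hne
    · rw [Function.update_self, Function.update_self]
      exact flatten_deepWrite ..
    · rw [Function.update_of_ne hne, Function.update_of_ne hne]

theorem flattenCfg_run (hk : 0 < k) (x : List α) (n : ℕ) :
    flattenCfg hk ((M.deepen hk).run x n) = M.run x n := by
  induction n with
  | zero =>
    refine congrArg (StorageAutomaton.Cfg.mk _ _ _) (funext fun i => ?_)
    rcases eq_or_ne i 0 with rfl | hne
    · simp [run, init, deepen, flatten]
    · simp [run, init, deepen, flatten, hne]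
  | succ n ih =>
    rw [run, run, Function.iterate_succ_apply', Function.iterate_succ_apply', flattenCfg_step]
    exact congrArg _ ih

theorem deepen_recognizes (hk : 0 < k) {L : Language α} (hL : M.Recognizes L) :
    (M.deepen hk).Recognizes L := by
  have key : ∀ x n, ((M.deepen hk).run x n).state = (M.run x n).state := fun x n =>
    congrArg Cfg.state (flattenCfg_run hk x n)
  refine ⟨fun x hx => ?_, fun x hx => ?_⟩
  · obtain ⟨n, hn⟩ := hL.1 x hx
    exact ⟨n, (key x n).symm ▸ hn⟩
  · obtain ⟨n, hn⟩ := hL.2 x hx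
    exact ⟨n, (key x n).symm ▸ hn⟩

end StorageAutomaton

theorem SDA_subset_succ {k : ℕ} (hk : 0 < k) (α : Type) : SDA k α ⊆ SDA (k + 1) α :=
  fun _ ⟨M, hM, hL⟩ => ⟨M.deepen hk, M.deepen_depthSusceptible hk hM, M.deepen_recognizes hk hL⟩

theorem SDA_two (α : Type) [Finite α] : SDA 2 α = DCFL α :=
  Set.Subset.antisymm (fun _ ⟨_, hM, hL⟩ => StorageAutomaton.mem_DCFL_of_recognizes hM hL)
    (fun _ ⟨_, hD⟩ => DPDA.mem_SDA_of_accepts hD)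

theorem lemma2p1 (α : Type) [Finite α] :
    SDA 2 α = DCFL α ∧
    ∀ k : ℕ, 2 ≤ k →
      DCFL α ⊆ SDA k α ∧ SDA k α ⊆ SDA (k + 1) α ∧ SDA (k + 1) α ⊆ omegaSDA α := by
  refine ⟨SDA_two α, fun k hk => ⟨?_, SDA_subset_succ (by omega) α,
    fun L hL => ⟨k + 1, by omega, hL⟩⟩⟩
  induction k, hk using Nat.le_induction with
  | base => exact (SDA_two α).ge
  | succ k hk ih => exact ih.trans (SDA_subset_succ (by omega) α)
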